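/- Let $G$ be a Lie group with Lie algebra $\mathfrak g$, let $H\subseteq G$ be a closed subgroup with Lie algebra $\mathfrak h$, and give $G/H$ the smooth structure for which the projection $\pi\colon G\to G/H$ is a smooth submersion. Suppose that $G/H$ is reductive: fix a vector space decomposition $\mathfrak g=\mathfrak h\oplus\mathfrak m$ with $\mathfrak m$ invariant under $\mathrm{Ad}(H)$. Let $[X,Y]_{\mathfrak m}$ denote the $\mathfrak m$-component of $[X,Y]$ for $X,Y\in\mathfrak m$, so that $(\mathfrak m,[\cdot,\cdot]_{\mathfrak m})$ is a non-associative algebra, and identify $\mathfrak m\cong T_{eH}(G/H)$ by means of $\mathrm d\pi_e$. Let $\langle\cdot,\cdot\rangle$ be a $G$-invariant Riemannian metric on $G/H$ with Levi-Civita connection $\nabla$. A $G$-invariant Codazzi tensor field on $G/H$ is a $G$-invariant smooth symmetric twice-covariant tensor field $A$ with $(\nabla_XA)(Y,Z)=(\nabla_YA)(X,Z)$ for all smooth vector fields $X,Y,Z$ on $G/H$. Its eigenspaces are the nonzero subspaces of $\mathfrak m$ of the form $\{X\in\mathfrak m : A(X,Y)=\lambda\langle X,Y\rangle \text{ for all }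 Y\in\mathfrak m\}$, $\lambda\in\mathbb R$. Such an $A$ is called essential if $\nabla A\neq 0$ and none of its eigenspaces is an ideal of $(\mathfrak m,[\cdot,\cdot]_{\mathfrak m})$. A non-associative algebra $\mathfrak a$ is called nilpotent if there is a positive integer $t$ such that every product of $t$ elements of $\mathfrak a$, no matter how associated, equals zero; it is called split-solvable if there is a sequence $\mathfrak a=\mathfrak a_0\supseteq\cdots\supseteq\mathfrak a_p=0$ of ideals of $\mathfrak a$ with $\dim(\mathfrak a_i/\mathfrak a_{i+1})=1$ for $i=0,\dots,p-1$. Proposition. If $G/H$ has an essential $G$-invariant Codazzi tensor field, then $(\mathfrak m,[\cdot,\cdot]_{\mathfrak m})$ is neither nilpotent nor split-solvable. -/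

import Mathlib

open scoped Manifold ContDiff

noncomputable section

/-! ### Non-associative algebras

A non-associative algebra is a real vector space `V` with a bilinear product `μ`. -/

section NonAssociative

variable {V : Type*} [AddCommGroup V] [Module ℝ V]

/-- `W` is a (two-sided) ideal of the non-associative algebra `(V, μ)`. -/
def IsAlgIdeal (μ : V →ₗ[ℝ] V →ₗ[ℝ] V) (W : Submodule ℝ V) : Prop :=
  ∀ x y : V, y ∈ W → μ x y ∈ W ∧ μ y x ∈ W

/-- The value in `(V, μ)` of a bracketed word, i.e. of a product of elements of `V` together with
a way of associating it. -/
def evalWord (μ : V →ₗ[ℝ] V →ₗ[ℝ] V) : FreeMagma V → V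
  | FreeMagma.of x => x
  | FreeMagma.mul a b => μ (evalWord μ a) (evalWord μ b)

/-- `(V, μ)` is nilpotent: there is a positive integer `t` such that every product of `t` elements,
no matter how associated, is zero. -/
def IsNilpotentAlg (μ : V →ₗ[ℝ] V →ₗ[ℝ] V) : Prop :=
  ∃ t : ℕ, 0 < t ∧ ∀ w : FreeMagma V, w.length = t → evalWord μ w = 0

/-- `(V, μ)` is split-solvable: there is a chain of ideals `V = a 0 ⊇ a 1 ⊇ ⋯ ⊇ a p = 0` with
`dim (a i / a (i + 1)) = 1` for all `i < p`. -/
def IsSplitSolvableAlg (μ : V →ₗ[ℝ] V →ₗ[ℝ] V) : Prop :=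
  ∃ (p : ℕ) (a : ℕ → Submodule ℝ V), a 0 = ⊤ ∧ a p = ⊥ ∧
    (∀ i ≤ p, IsAlgIdeal μ (a i)) ∧
    ∀ i < p, a (i + 1) ≤ a i ∧ Module.finrank ℝ (a i ⧸ (a (i + 1)).submoduleOf (a i)) = 1

end NonAssociative

/-! ### Connections and twice-covariant tensor fields on a manifold -/

section Tensors

variable {F : Type*} [NormedAddCommGroup F] [NormedSpace ℝ F]
  {M : Type*} [TopologicalSpace M] [ChartedSpace F M]

/-- Smoothness of a vector field on `M`. -/
def IsSmoothVF [IsManifold 𝓘(ℝ, F) ∞ M] (X : Π x : M, TangentSpace 𝓘(ℝ, F) x) : Prop :=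
  ContMDiff 𝓘(ℝ, F) 𝓘(ℝ, F).tangent ∞ (fun x ↦ (⟨x, X x⟩ : TangentBundle 𝓘(ℝ, F) M))

variable (F M) in
/-- A smooth twice-covariant symmetric tensor field on `M`. -/
structure SymTensorField [IsManifold 𝓘(ℝ, F) ∞ M] where
  /-- The bilinear form on each tangent space. -/
  form : Π x : M, TangentSpace 𝓘(ℝ, F) x →L[ℝ] TangentSpace 𝓘(ℝ, F) x →L[ℝ] ℝ
  symm : ∀ (x : M) (v w : TangentSpace 𝓘(ℝ, F) x), form x v w = form x w v
  contMDiff : ContMDiff 𝓘(ℝ, F) (𝓘(ℝ, F).prod 𝓘(ℝ, F →L[ℝ] F →L[ℝ] ℝ)) ∞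
    (fun x ↦ Bundle.TotalSpace.mk' (F →L[ℝ] F →L[ℝ] ℝ)
      (E := fun x : M ↦ TangentSpace 𝓘(ℝ, F) x →L[ℝ] TangentSpace 𝓘(ℝ, F) x →L[ℝ] ℝ) x (form x))

variable (F M) in
/-- A smooth Riemannian metric on `M`. -/
abbrev SmoothMetric [IsManifold 𝓘(ℝ, F) ∞ M] :=
  Bundle.ContMDiffRiemannianMetric 𝓘(ℝ, F) ∞ F (fun x : M ↦ TangentSpace 𝓘(ℝ, F) x)

variable (F M) in
/-- A connection on (the tangent bundle of) `M`; `nabla Y x (X x)` is `(∇_X Y)(x)`. -/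
abbrev TangentConnection [IsManifold 𝓘(ℝ, F) ∞ M] :=
  CovariantDerivative 𝓘(ℝ, F) F (fun x : M ↦ TangentSpace 𝓘(ℝ, F) x)

/-- The value at `x` of the covariant derivative of a twice-covariant tensor field:
`(∇_X B)(Y, Z) = X (B(Y, Z)) - B(∇_X Y, Z) - B(Y, ∇_X Z)`. -/
def covDerivTensor [IsManifold 𝓘(ℝ, F) ∞ M] (nabla : TangentConnection F M)
    (B : Π x : M, TangentSpace 𝓘(ℝ, F) x →L[ℝ] TangentSpace 𝓘(ℝ, F) x →L[ℝ] ℝ)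
    (X Y Z : Π x : M, TangentSpace 𝓘(ℝ, F) x) (x : M) : ℝ :=
  mvfderiv 𝓘(ℝ, F) (fun y ↦ B y (Y y) (Z y)) x (X x)
    - B x (nabla Y x (X x)) (Z x) - B x (Y x) (nabla Z x (X x))

/-- `nabla` is the Levi-Civita connection of `g`: it is torsion-free, and `∇g = 0`. -/
structure IsLeviCivita [FiniteDimensional ℝ F] [IsManifold 𝓘(ℝ, F) ∞ M]
    (g : SmoothMetric F M) (nabla : TangentConnection F M) : Prop where
  torsion_free :
    haveI : CompleteSpace F := FiniteDimensional.complete ℝ F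
    nabla.torsion = 0
  metric : ∀ X Y Z : Π x : M, TangentSpace 𝓘(ℝ, F) x, IsSmoothVF X → IsSmoothVF Y →
    IsSmoothVF Z → ∀ x : M, covDerivTensor nabla g.inner X Y Z x = 0

/-- `A` is a Codazzi tensor field with respect to the (torsion-free) connection `nabla`:
`(∇_X A)(Y, Z) = (∇_Y A)(X, Z)` for all smooth vector fields `X`, `Y`, `Z`. -/
def IsCodazzi [IsManifold 𝓘(ℝ, F) ∞ M] (nabla : TangentConnection F M)
    (A : SymTensorField F M) : Prop :=
  ∀ X Y Z : Π x : M, TangentSpace 𝓘(ℝ, F) x, IsSmoothVF X → IsSmoothVF Y → IsSmoothVF Z →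
    ∀ x : M, covDerivTensor nabla A.form X Y Z x = covDerivTensor nabla A.form Y X Z x

/-- `∇A = 0`. -/
def IsParallel [IsManifold 𝓘(ℝ, F) ∞ M] (nabla : TangentConnection F M)
    (A : SymTensorField F M) : Prop :=
  ∀ X Y Z : Π x : M, TangentSpace 𝓘(ℝ, F) x, IsSmoothVF X → IsSmoothVF Y → IsSmoothVF Z →
    ∀ x : M, covDerivTensor nabla A.form X Y Z x = 0

/-- A field of bilinear forms on `M` is `G`-invariant: it is preserved by the derivatives of all
the translations `τ_a : x ↦ a • x`, `a ∈ G`. -/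
def IsInvariantForm (G : Type*) [Group G] [MulAction G M]
    (B : Π x : M, TangentSpace 𝓘(ℝ, F) x →L[ℝ] TangentSpace 𝓘(ℝ, F) x →L[ℝ] ℝ) : Prop :=
  ∀ (a : G) (x : M) (v w : TangentSpace 𝓘(ℝ, F) x),
    B (a • x) (mfderiv 𝓘(ℝ, F) 𝓘(ℝ, F) (fun y : M ↦ a • y) x v)
      (mfderiv 𝓘(ℝ, F) 𝓘(ℝ, F) (fun y : M ↦ a • y) x w) = B x v w

end Tensors

/-! ### Lie groups, closed subgroups and reductive decompositions -/

theorem mfderiv_mul_curves {E : Type*} [NormedAddCommGroup E] [NormedSpace ℝ E]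
  {G : Type*} [TopologicalSpace G] [ChartedSpace E G] [Group G] [LieGroup 𝓘(ℝ, E) ∞ G]
  {γ δ : ℝ → G} (hγ : ContMDiff 𝓘(ℝ, ℝ) 𝓘(ℝ, E) ∞ γ) (hδ : ContMDiff 𝓘(ℝ, ℝ) 𝓘(ℝ, E) ∞ δ)
  (h0 : γ 0 = 1) (h0' : δ 0 = 1) {v w : E}
  (hv : v = mfderiv 𝓘(ℝ, ℝ) 𝓘(ℝ, E) γ 0 (1 : ℝ)) (hw : w = mfderiv 𝓘(ℝ, ℝ) 𝓘(ℝ, E) δ 0 (1 : ℝ)) :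
   v + w = mfderiv 𝓘(ℝ, ℝ) 𝓘(ℝ, E) (fun t ↦ γ t * δ t) 0 (1 : ℝ) := by
  have hn : (∞ : ℕ∞ω) ≠ 0 := by simp
  have dγ := (hγ.mdifferentiable hn) 0
  have dδ := (hδ.mdifferentiable hn) 0
  have hm : MDifferentiable (𝓘(ℝ, E).prod 𝓘(ℝ, E)) 𝓘(ℝ, E) (fun p : G × G ↦ p.1 * p.2) :=
    (contMDiff_mul 𝓘(ℝ, E) ∞).mdifferentiable hn
  have h1 := ((hm (γ 0, δ 0)).hasMFDerivAt.comp (0 : ℝ)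
    (dγ.hasMFDerivAt.prodMk dδ.hasMFDerivAt)).mfderiv
  have h2 : mfderiv 𝓘(ℝ, ℝ) 𝓘(ℝ, E) (fun t ↦ γ t * δ t) 0 (1 : ℝ) =
      (mfderiv (𝓘(ℝ, E).prod 𝓘(ℝ, E)) 𝓘(ℝ, E) (fun p : G × G ↦ p.1 * p.2) (γ 0, δ 0)) (v, w) := by
    rw [hv, hw]
    exact congrArg (fun (f : ℝ →L[ℝ] E) ↦ f (1 : ℝ)) h1
  refine Eq.trans ?_ h2.symm
  refine Eq.trans ?_ (mfderiv_prod_eq_add_apply (hm (γ 0, δ 0))).symm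
  rw [h0, h0']
  have key : ∀ (f : G → G) (u : E), f = id →
      (mfderiv 𝓘(ℝ, E) 𝓘(ℝ, E) f 1 : E →L[ℝ] E) u = u := by
    rintro _ u rfl
    rw [mfderiv_id]
    rfl
  exact (congrArg₂ (fun x y : E ↦ x + y) (key (fun z ↦ z * 1) v (by ext; simp))
    (key (fun z ↦ 1 * z) w (by ext; simp))).symm

theorem mfderiv_smul_curve {E : Type*} [NormedAddCommGroup E] [NormedSpace ℝ E]
  {G : Type*} [TopologicalSpace G] [ChartedSpace E G]
  {γ : ℝ → G} (hγ : ContMDiff 𝓘(ℝ, ℝ) 𝓘(ℝ, E) ∞ γ) (c : ℝ) {v : E}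
  (hv : v = mfderiv 𝓘(ℝ, ℝ) 𝓘(ℝ, E) γ 0 (1 : ℝ)) :
   c • v = mfderiv 𝓘(ℝ, ℝ) 𝓘(ℝ, E) (fun t ↦ γ (c * t)) 0 (1 : ℝ) := by
  have hn : (∞ : ℕ∞ω) ≠ 0 := by simp
  have dγ := (hγ.mdifferentiable hn) (c * 0)
  have hl : HasMFDerivAt 𝓘(ℝ, ℝ) 𝓘(ℝ, ℝ) (fun t : ℝ ↦ c * t) 0 (c • ContinuousLinearMap.id ℝ ℝ) :=
    (((hasFDerivAt_id (0 : ℝ)).const_mul c)).hasMFDerivAt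
  have h1 := (dγ.hasMFDerivAt.comp (0 : ℝ) hl).mfderiv
  have h2 : mfderiv 𝓘(ℝ, ℝ) 𝓘(ℝ, E) (fun t ↦ γ (c * t)) 0 (1 : ℝ)
     = mfderiv 𝓘(ℝ, ℝ) 𝓘(ℝ, E) γ (c * 0) ((c * 1 : ℝ)) := by
    exact congrArg (fun (f : ℝ →L[ℝ] E) ↦ f (1 : ℝ)) h1
  refine Eq.trans ?_ h2.symm
  have h3 := (mfderiv 𝓘(ℝ, ℝ) 𝓘(ℝ, E) γ 0 : ℝ →L[ℝ] E).map_smul c (1 : ℝ)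
  rw [mul_zero, hv]
  exact h3.symm

section Reductive

variable {E : Type*} [NormedAddCommGroup E] [NormedSpace ℝ E]
  {G : Type*} [TopologicalSpace G] [ChartedSpace E G] [Group G]

/-- The Lie algebra of the closed subgroup `H`, as a subspace of the Lie algebra `T_1 G` of `G`:
the velocities at `t = 0` of smooth curves in `G` through `1` with values in `H`. -/
def subgroupLieAlgebra [LieGroup 𝓘(ℝ, E) ∞ G] (H : Subgroup G) :
    Submodule ℝ (GroupLieAlgebra 𝓘(ℝ, E) G) where
  carrier := {X | ∃ γ : ℝ → G, ContMDiff 𝓘(ℝ, ℝ) 𝓘(ℝ, E) ∞ γ ∧ γ 0 = 1 ∧ (∀ t, γ t ∈ H) ∧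
    X = mfderiv 𝓘(ℝ, ℝ) 𝓘(ℝ, E) γ 0 (1 : ℝ)}
  zero_mem' := by
    refine ⟨fun _ ↦ 1, contMDiff_const, rfl, fun _ ↦ H.one_mem, ?_⟩
    rw [mfderiv_const]
    rfl
  add_mem' := by
    rintro X Y ⟨γ, hγ, h0, hH, hX⟩ ⟨δ, hδ, h0', hH', hY⟩
    exact ⟨fun t ↦ γ t * δ t, hγ.mul hδ, by simp [h0, h0'], fun t ↦ H.mul_mem (hH t) (hH' t),
      mfderiv_mul_curves hγ hδ h0 h0' hX hY⟩
  smul_mem' := by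
    rintro c X ⟨γ, hγ, h0, hH, hX⟩
    exact ⟨fun t ↦ γ (c * t), hγ.comp (contDiff_const.mul contDiff_id).contMDiff, by simp [h0],
      fun t ↦ hH _, mfderiv_smul_curve hγ c hX⟩

/-- The adjoint action `Ad(h)`: the derivative at `1` of the conjugation `a ↦ h a h⁻¹`. -/
def groupAd (h : G) (X : GroupLieAlgebra 𝓘(ℝ, E) G) : GroupLieAlgebra 𝓘(ℝ, E) G :=
  mfderiv 𝓘(ℝ, E) 𝓘(ℝ, E) (fun a : G ↦ h * a * h⁻¹) 1 X

variable (E) in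
/-- A reductive decomposition `𝔤 = 𝔥 ⊕ 𝔪`: a vector space complement `𝔪` of the Lie algebra `𝔥`
of `H` which is `Ad(H)`-invariant. -/
structure ReductiveDecomposition [LieGroup 𝓘(ℝ, E) ∞ G] (H : Subgroup G) where
  /-- The reductive complement. -/
  m : Submodule ℝ (GroupLieAlgebra 𝓘(ℝ, E) G)
  isCompl : IsCompl m (subgroupLieAlgebra H)
  ad_mem : ∀ h ∈ H, ∀ X ∈ m, groupAd h X ∈ m

namespace ReductiveDecomposition

variable [LieGroup 𝓘(ℝ, E) ∞ G] {H : Subgroup G}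

theorem lieGroup_minSmoothness : LieGroup 𝓘(ℝ, E) (minSmoothness ℝ 3) G := by
  rw [minSmoothness_of_isRCLikeNormedField]
  infer_instance

/-- The product `[X, Y]_𝔪` of the non-associative algebra `𝔪`: the `𝔪`-component, with respect to
`𝔤 = 𝔥 ⊕ 𝔪`, of the Lie bracket of `𝔤`. -/
def bracket [FiniteDimensional ℝ E] (D : ReductiveDecomposition E H) :
    D.m →ₗ[ℝ] D.m →ₗ[ℝ] D.m :=
  haveI : CompleteSpace E := FiniteDimensional.complete ℝ E
  haveI : LieGroup 𝓘(ℝ, E) (minSmoothness ℝ 3) G := lieGroup_minSmoothness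
  LinearMap.mk₂ ℝ
    (fun X Y ↦ D.m.projectionOnto (subgroupLieAlgebra H) D.isCompl
      ⁅(X : GroupLieAlgebra 𝓘(ℝ, E) G), (Y : GroupLieAlgebra 𝓘(ℝ, E) G)⁆)
    (fun X X' Y ↦ by rw [Submodule.coe_add, add_lie, map_add])
    (fun c X Y ↦ by rw [Submodule.coe_smul, smul_lie, map_smul])
    (fun X Y Y' ↦ by rw [Submodule.coe_add, lie_add, map_add])
    (fun c X Y ↦ by rw [Submodule.coe_smul, lie_smul, map_smul])

end ReductiveDecomposition

end Reductive

/-! ### Invariant Codazzi tensor fields on `G ⧸ H` -/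

section Homogeneous

variable {E F : Type*} [NormedAddCommGroup E] [NormedSpace ℝ E] [FiniteDimensional ℝ E]
  [NormedAddCommGroup F] [NormedSpace ℝ F] [FiniteDimensional ℝ F]
  {G : Type*} [TopologicalSpace G] [ChartedSpace E G] [Group G] [LieGroup 𝓘(ℝ, E) ∞ G]
  {H : Subgroup G} [ChartedSpace F (G ⧸ H)]

namespace ReductiveDecomposition

/-- The restriction to `𝔪` of the derivative at `1` of the projection `π : G → G ⧸ H`, with values
in the tangent space of `G ⧸ H` at the coset of `1`. -/
def toTangent (D : ReductiveDecomposition E H) :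
    D.m →ₗ[ℝ] TangentSpace 𝓘(ℝ, F) ((1 : G) : G ⧸ H) :=
  (mfderiv 𝓘(ℝ, E) 𝓘(ℝ, F) (fun a : G ↦ (a : G ⧸ H)) 1).toLinearMap ∘ₗ D.m.subtype

variable [IsManifold 𝓘(ℝ, F) ∞ (G ⧸ H)]

/-- For `c : ℝ`, the subspace of those `X ∈ 𝔪` with `A(X, Y) = c ⟨X, Y⟩` for all `Y ∈ 𝔪`, where
`A` and the metric `g` are seen as bilinear forms on `𝔪` by means of `𝔪 ≅ T_{eH}(G ⧸ H)`. It is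
the eigenspace of `A` for `c` if `c` is an eigenvalue, and zero otherwise. -/
def eigenspace (D : ReductiveDecomposition E H) (g : SmoothMetric F (G ⧸ H))
    (A : SymTensorField F (G ⧸ H)) (c : ℝ) : Submodule ℝ D.m where
  carrier := {X | ∀ Y : D.m,
    A.form ((1 : G) : G ⧸ H) (D.toTangent X) (D.toTangent Y)
      = c * g.inner ((1 : G) : G ⧸ H) (D.toTangent X) (D.toTangent Y)}
  zero_mem' Y := by simp
  add_mem' {X X'} hX hX' Y := by
    have h1 := hX Y
    have h2 := hX' Y
    simp only [map_add, add_apply]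
    rw [h1, h2, mul_add]
  smul_mem' r X hX Y := by
    have h1 := hX Y
    simp only [map_smul, smul_apply, smul_eq_mul]
    rw [h1]
    ring

/-- `A` is an essential `G`-invariant Codazzi tensor field on `G ⧸ H` (with the metric `g`, its
Levi-Civita connection `nabla`, and the reductive decomposition `D`): it is a `G`-invariant Codazzi
tensor field, `∇A ≠ 0`, and none of its eigenspaces in `𝔪` is an ideal of `(𝔪, [·,·]_𝔪)`. -/
structure IsEssentialCodazzi (D : ReductiveDecomposition E H) (g : SmoothMetric F (G ⧸ H))
    (nabla : TangentConnection F (G ⧸ H)) (A : SymTensorField F (G ⧸ H)) : Prop where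
  invariant : IsInvariantForm G A.form
  codazzi : IsCodazzi nabla A
  not_parallel : ¬ IsParallel nabla A
  not_ideal : ∀ c : ℝ, D.eigenspace g A c ≠ ⊥ → ¬ IsAlgIdeal D.bracket (D.eigenspace g A c)

end ReductiveDecomposition

end Homogeneous

end

/-! Everything reduces to algebra on `𝔪`. For `X` in `𝔪` let `X*` be the fundamental field of the
action on `G ⧸ H`, and let `L X Y` be the element of `𝔪` corresponding to `∇_{Y*} X*` at the base
point. Vanishing torsion and `[X*, Y*] = -[X, Y]*` give `L X Y - L Y X = [X, Y]_𝔪`. If `B` is an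
invariant form, its Lie derivative along `X*` vanishes, so with vanishing torsion `(∇_{X*} B)(Y*,
Z*) = -B(L X Y, Z) - B(Y, L X Z)` at the base point. Hence `L X` is skew for the metric, and the
Codazzi equation becomes an identity between `A`, `L` and the product (`isAlgIdeal_eigenspace`).

Write `A(x, y) = g(S x, y)`, let `S x = c x` and `T = S - c`. Eliminating `L` by the Koszul formula,
the Codazzi identity says that `ad x = [x, ·]_𝔪` is skew for the positive semidefinite form `g(T u,
T v)` (`skew_of_codazzi`). A skew operator that is nilpotent, or triangular over `ℝ` in a full flag,
is zero modulo the radical of the form. So `T ∘ ad x = 0`: products with `x` stay in `ker T`, and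
every eigenspace is an ideal (`isAlgIdeal_of_codazzi`).

If `𝔪 ≠ 0`, the symmetric operator `S` has an eigenvalue, and its eigenspace contradicts
essentiality. If `𝔪 = 0`, the tangent spaces vanish and `∇A = 0`, again a contradiction. -/

noncomputable section

/-! ### Algebra: Codazzi forms on a non-associative algebra. -/

section CodazziAlgebra

variable {V : Type*} [AddCommGroup V] [Module ℝ V]

/-- If `ad` is skew-symmetric for the positive semidefinite form `g (T u) (T v)` and nilpotent, then
`T ∘ ad = 0`. -/
theorem comp_eq_zero_of_skew_of_pow_eq_zero (g : V →ₗ[ℝ] V →ₗ[ℝ] ℝ)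
    (hpos : ∀ x, g x x = 0 → x = 0) (T ad : V →ₗ[ℝ] V)
    (hskew : ∀ u v, g (T (ad u)) (T v) = -g (T u) (T (ad v))) {n : ℕ} (hn : ad ^ n = 0) (u : V) :
    T (ad u) = 0 := by
  -- Descent on the exponent: if `T ad^(m+2) = 0`, skewness gives `|T ad^(m+1) u|² = -g(T ad^m u, T
  -- ad^(m+2) u) = 0`.
  have key : ∀ m : ℕ, (∀ u, T ((ad ^ (m + 1)) u) = 0) → ∀ u, T (ad u) = 0 := by
    intro m
    induction m with
    | zero => simp
    | succ m ih =>
      intro h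
      refine ih fun u ↦ hpos _ ?_
      have h1 : (ad ^ (m + 1)) u = ad ((ad ^ m) u) := by rw [pow_succ']; rfl
      have h2 : (ad ^ (m + 1 + 1)) u = ad ((ad ^ (m + 1)) u) := by rw [pow_succ']; rfl
      have h3 := hskew ((ad ^ m) u) ((ad ^ (m + 1)) u)
      rw [← h2, h u, map_zero, neg_zero, ← h1] at h3
      exact h3
  refine key n (fun u ↦ ?_) u
  rw [pow_succ', hn]
  simp

/-- If `ad` is skew-symmetric for the positive semidefinite form `g (T u) (T v)` and preserves a
full flag, then `T ∘ ad = 0`. -/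
theorem comp_eq_zero_of_skew_of_flag (g : V →ₗ[ℝ] V →ₗ[ℝ] ℝ)
    (hpos : ∀ x, g x x = 0 → x = 0) (T ad : V →ₗ[ℝ] V)
    (hskew : ∀ u v, g (T (ad u)) (T v) = -g (T u) (T (ad v))) (hsymm : ∀ u v, g u v = g v u)
    {p : ℕ} {a : ℕ → Submodule ℝ V} (h0 : a 0 = ⊤) (hp : a p = ⊥)
    (hflag : ∀ i < p, ∀ u ∈ a i, u ∉ a (i + 1) → ∃ c : ℝ, ad u - c • u ∈ a (i + 1)) (u : V) :
    T (ad u) = 0 := by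
  -- Induction from the bottom of the flag upwards. If `ad u = c u` modulo the next step, then `T
  -- ad² u = c T ad u` by induction, so `|T ad u|² = -c g(T u, T ad u)`, which vanishes by skewness
  -- applied to `u, u`.
  have key : ∀ k ≤ p, ∀ u ∈ a (p - k), T (ad u) = 0 := by
    intro k
    induction k with
    | zero => intro _ u hu; simp_all
    | succ k ih =>
      intro hk u hu
      have e : p - k = p - (k + 1) + 1 := by omega
      by_cases hu' : u ∈ a (p - k)
      · exact ih (by omega) u hu'
      obtain ⟨c, hc⟩ := hflag (p - (k + 1)) (by omega) u hu (e ▸ hu')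
      have h1 := ih (by omega) _ (e ▸ hc)
      have h2 : g (T (ad u)) (T u) = 0 := by
        have := hskew u u
        rw [hsymm (T u)] at this
        linarith
      have h3 := hskew u (ad u)
      rw [map_sub, map_sub, map_smul, map_smul, sub_eq_zero] at h1
      refine hpos _ ?_
      rw [h3, h1, map_smul, hsymm, h2]
      simp
  exact key p le_rfl u (by simp [h0])

/-- The value of a Codazzi form on the eigenvectors of its operator `S`: left multiplication by an
eigenvector is skew-symmetric for `g (T u) (T v)` with `T = S - c`. -/
theorem skew_of_codazzi (μ : V →ₗ[ℝ] V →ₗ[ℝ] V) (hμ : ∀ x y, μ x y = -μ y x)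
    (g : V →ₗ[ℝ] V →ₗ[ℝ] ℝ) (hg : ∀ x y, g x y = g y x) (S : V →ₗ[ℝ] V)
    (hS : ∀ x y, g (S x) y = g x (S y)) (L : V → V → V)
    (htor : ∀ x y, L x y - L y x = μ x y) (hmet : ∀ x y z, g (L z x) y + g x (L z y) = 0)
    (hcod : ∀ x y z, g (S (L x y)) z + g (S y) (L x z) = g (S (L y x)) z + g (S x) (L y z))
    {c : ℝ} {x : V} (hx : S x = c • x) (T : V →ₗ[ℝ] V) (hT : T = S - c • LinearMap.id) (u v : V) :
    g (T (μ x u)) (T v) = -g (T u) (T (μ x v)) := by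
  -- Koszul formula: a torsion-free metric `L` is determined by `μ` and `g`, so `L` can be
  -- eliminated from the Codazzi identity.
  have koszul : ∀ x y z, 2 * g (L x y) z = g (μ x y) z + g (μ z x) y + g (μ z y) x := by
    intro x y z
    have m1 := hmet y z x
    have m2 := hmet x z y
    have m3 := hmet x y z
    rw [← htor x y, ← htor z x, ← htor z y]
    simp only [map_sub, LinearMap.sub_apply]
    rw [hg x (L z y)] at m3
    rw [hg x (L y z)] at m2
    rw [hg y (L x z)] at m1
    linarith
  have cod : ∀ x y z, 2 * g (μ x y) (S z) + (g (μ x z) (S y) + g (μ (S y) x) z + g (μ (S y) z) x)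
      - (g (μ y z) (S x) + g (μ (S x) y) z + g (μ (S x) z) y) = 0 := by
    intro x y z
    have h := hcod x y z
    rw [← koszul, ← koszul, ← htor, hg (L x z), hg (L y z)]
    simp only [map_sub, LinearMap.sub_apply, hS] at h ⊢
    linarith
  have T_symm : ∀ x y, g (T x) y = g x (T y) := by
    intro x y
    simp [hT, hS]
  -- For an eigenvector `x`, replacing `S` by `T + c` cancels all the terms containing `c`.
  have main : ∀ y z, 2 * g (μ x y) (T z) - g (μ x (T y)) z + g (μ x z) (T y)
      + g (μ (T y) z) x = 0 := by
    intro y z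
    have h := cod x y z
    rw [hx, hμ (S y) x] at h
    subst hT
    simp only [map_sub, map_smul, map_neg, LinearMap.sub_apply, LinearMap.smul_apply,
      LinearMap.neg_apply, LinearMap.id_apply, smul_eq_mul] at h ⊢
    linarith
  -- Adding these two instances of `main` cancels everything but `2 g(μ x u, T² v) + 2 g(μ x v, T²
  -- u)`; symmetry of `T` then moves one factor across.
  have h1 := main u (T v)
  have h2 := main v (T u)
  rw [hμ (T v), map_neg, LinearMap.neg_apply] at h2
  rw [hg (T u), T_symm, T_symm (μ x v)]
  linarith

/-- Only the right-nested words `x(x(⋯(x u)))` are needed from nilpotency. -/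
theorem exists_pow_eq_zero_of_isNilpotentAlg {μ : V →ₗ[ℝ] V →ₗ[ℝ] V} (h : IsNilpotentAlg μ)
    (x : V) : ∃ n : ℕ, μ x ^ n = 0 := by
  obtain ⟨t, ht, h⟩ := h
  refine ⟨t, LinearMap.ext fun u ↦ ?_⟩
  have key : ∀ n : ℕ, ∃ w : FreeMagma V, w.length = n + 1 ∧ evalWord μ w = (μ x ^ n) u := by
    intro n
    induction n with
    | zero => exact ⟨FreeMagma.of u, rfl, rfl⟩
    | succ n ih =>
      obtain ⟨w, hw, hw'⟩ := ih
      refine ⟨FreeMagma.mul (FreeMagma.of x) w, ?_, ?_⟩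
      · change 1 + w.length = _
        omega
      · rw [pow_succ']
        change μ x (evalWord μ w) = _
        rw [hw']
        rfl
  obtain ⟨s, rfl⟩ : ∃ s, t = s + 1 := ⟨t - 1, by omega⟩
  obtain ⟨w, hw, hw'⟩ := key s
  rw [pow_succ']
  change μ x ((μ x ^ s) u) = 0
  rw [← hw']
  by_contra hne
  have := h w hw
  rw [this, map_zero] at hne
  exact hne rfl

/-- The class of `u` spans the one-dimensional quotient. With `v = ad u`, this makes `ad` triangular
along a flag of ideals. -/
theorem exists_sub_smul_mem_of_finrank_quotient_eq_one {W W' : Submodule ℝ V}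
    (h : Module.finrank ℝ (W ⧸ W'.submoduleOf W) = 1) {u v : V} (hu : u ∈ W) (hu' : u ∉ W')
    (hv : v ∈ W) : ∃ c : ℝ, v - c • u ∈ W' := by
  have hne : (W'.submoduleOf W).mkQ ⟨u, hu⟩ ≠ 0 := by
    rw [Submodule.mkQ_apply, Ne, Submodule.Quotient.mk_eq_zero]
    exact hu'
  obtain ⟨c, hc⟩ := (finrank_eq_one_iff_of_nonzero' _ hne).1 h ((W'.submoduleOf W).mkQ ⟨v, hv⟩)
  refine ⟨c, ?_⟩
  rw [← map_smul, eq_comm, Submodule.mkQ_apply, Submodule.mkQ_apply, Submodule.Quotient.eq] at hc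
  exact hc

/-- The eigenspaces of a Codazzi form on a nilpotent or split-solvable algebra are ideals. -/
theorem isAlgIdeal_of_codazzi (μ : V →ₗ[ℝ] V →ₗ[ℝ] V) (hμ : ∀ x y, μ x y = -μ y x)
    (hsolv : IsNilpotentAlg μ ∨ IsSplitSolvableAlg μ)
    (g : V →ₗ[ℝ] V →ₗ[ℝ] ℝ) (hg : ∀ x y, g x y = g y x) (hpos : ∀ x, g x x = 0 → x = 0)
    (S : V →ₗ[ℝ] V) (hS : ∀ x y, g (S x) y = g x (S y)) (L : V → V → V)
    (htor : ∀ x y, L x y - L y x = μ x y) (hmet : ∀ x y z, g (L z x) y + g x (L z y) = 0)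
    (hcod : ∀ x y z, g (S (L x y)) z + g (S y) (L x z) = g (S (L y x)) z + g (S x) (L y z))
    (c : ℝ) : IsAlgIdeal μ (LinearMap.ker (S - c • LinearMap.id)) := by
  have key : ∀ x u, x ∈ LinearMap.ker (S - c • LinearMap.id) →
      μ x u ∈ LinearMap.ker (S - c • LinearMap.id) := by
    intro x u hx
    have hx' : S x = c • x := by simpa [sub_eq_zero] using hx
    have hskew := skew_of_codazzi μ hμ g hg S hS L htor hmet hcod hx' _ rfl
    rw [LinearMap.mem_ker]
    rcases hsolv with h | ⟨p, a, h0, hp, hid, hflag⟩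
    · obtain ⟨n, hn⟩ := exists_pow_eq_zero_of_isNilpotentAlg h x
      exact comp_eq_zero_of_skew_of_pow_eq_zero g hpos _ (μ x) hskew hn u
    · exact comp_eq_zero_of_skew_of_flag g hpos _ (μ x) hskew hg h0 hp
        (fun i hi v hv hv' ↦
          exists_sub_smul_mem_of_finrank_quotient_eq_one (hflag i hi).2 hv hv'
            (hid i hi.le x v hv).1) u
  intro x y hy
  refine ⟨?_, key y x hy⟩
  rw [hμ]
  exact Submodule.neg_mem _ (key y x hy)

/-- A symmetric operator on a nonzero finite-dimensional space has an eigenvalue. -/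
theorem exists_ker_sub_smul_ne_bot [FiniteDimensional ℝ V] [Nontrivial V]
    (g : V →ₗ[ℝ] V →ₗ[ℝ] ℝ) (hg : ∀ x y, g x y = g y x) (hpos : ∀ x, x ≠ 0 → 0 < g x x)
    (S : V →ₗ[ℝ] V) (hS : ∀ x y, g (S x) y = g x (S y)) :
    ∃ c : ℝ, LinearMap.ker (S - c • LinearMap.id) ≠ ⊥ := by
  let core : InnerProductSpace.Core ℝ V :=
    { inner := fun x y ↦ g x y
      conj_inner_symm := fun x y ↦ by simpa using hg y x
      re_inner_nonneg := fun x ↦ by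
        rcases eq_or_ne x 0 with rfl | hx
        · simp
        · exact (hpos x hx).le
      add_left := fun x y z ↦ by simp
      smul_left := fun x y r ↦ by simp
      definite := fun x hx ↦ by
        by_contra h
        exact (hpos x h).ne' hx }
  let := core.toNormedAddCommGroup
  let : InnerProductSpace ℝ V := InnerProductSpace.ofCore core.toCore
  obtain ⟨r, hr⟩ : ∃ r : ℝ, Module.End.HasEigenvalue S r :=
    ⟨_, LinearMap.IsSymmetric.hasEigenvalue_iSup_of_finiteDimensional (T := S) hS⟩
  obtain ⟨v, hv⟩ := hr.exists_hasEigenvector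
  refine ⟨r, (Submodule.ne_bot_iff _).2 ⟨v, ?_, hv.2⟩⟩
  rw [LinearMap.mem_ker, LinearMap.sub_apply, hv.apply_eq_smul, sub_eq_zero]
  rfl

/-- A bilinear form is represented by an operator with respect to a nondegenerate form. -/
theorem exists_operator_of_bilinForm [FiniteDimensional ℝ V]
    (g A : V →ₗ[ℝ] V →ₗ[ℝ] ℝ) (hpos : ∀ x, g x x = 0 → x = 0) :
    ∃ S : V →ₗ[ℝ] V, ∀ x y, g (S x) y = A x y := by
  have hinj : Function.Injective (g : V →ₗ[ℝ] Module.Dual ℝ V) := by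
    rw [injective_iff_map_eq_zero]
    intro x hx
    exact hpos x (by rw [hx]; rfl)
  let e := LinearEquiv.ofInjectiveOfFinrankEq (g : V →ₗ[ℝ] Module.Dual ℝ V) hinj
    Subspace.dual_finrank_eq.symm
  refine ⟨e.symm.toLinearMap ∘ₗ A, fun x y ↦ ?_⟩
  have : e (e.symm (A x)) = A x := e.apply_symm_apply _
  exact congrArg (fun f : Module.Dual ℝ V ↦ f y) this

end CodazziAlgebra

/-! ### Submersions: local sections and curves in fibers. -/

section Submersion

open Filter Topology

variable {E F : Type*} [NormedAddCommGroup E] [NormedSpace ℝ E]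
  [NormedAddCommGroup F] [NormedSpace ℝ F]
  {M : Type*} [TopologicalSpace M] [ChartedSpace E M]
  {N : Type*} [TopologicalSpace N] [ChartedSpace F N]

/-- A submersion has a smooth local section through each point. -/
theorem Manifold.IsSubmersionAt.exists_local_section {f : M → N} {x : M}
    (hf : Manifold.IsSubmersionAt 𝓘(ℝ, E) 𝓘(ℝ, F) ∞ f x) :
    ∃ σ : N → M, ContMDiffAt 𝓘(ℝ, F) 𝓘(ℝ, E) ∞ σ (f x) ∧ σ (f x) = x ∧
      ∀ᶠ p in 𝓝 (f x), f (σ p) = p := by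
  have hw := hf.writtenInCharts
  have hxs := hf.mem_domChart_source
  have hxt := hf.mem_codChart_source
  have hsm := contMDiffOn_symm_of_mem_maximalAtlas hf.domChart_mem_maximalAtlas
  have hcm := contMDiffOn_of_mem_maximalAtlas hf.codChart_mem_maximalAtlas
  have hsub := hf.source_subset_preimage_source
  set φ := hf.domChart
  set ψ := hf.codChart
  set e := hf.equiv
  -- In adapted charts `f` is the projection to the first factor. The section keeps the
  -- complementary coordinate of `x` fixed, so it passes through `x`.
  have hx0 : e.symm (ψ (f x), (e (φ x)).2) = φ x := by
    have h1 := hw (x := φ x) (by simpa using φ.map_source hxs)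
    have h2 : ψ (f x) = (e (φ x)).1 := by simpa [φ.left_inv hxs] using h1
    rw [h2]
    simp
  have hin : ContMDiffAt 𝓘(ℝ, F) 𝓘(ℝ, E) ∞ (fun p ↦ e.symm (ψ p, (e (φ x)).2)) (f x) := by
    have h1 : ContDiff ℝ ∞ (fun y : F ↦ e.symm (y, (e (φ x)).2)) := by fun_prop
    exact h1.contMDiff.contMDiffAt.comp (f x)
      ((hcm (f x) hxt).contMDiffAt (ψ.open_source.mem_nhds hxt))
  have hev : ∀ᶠ p in 𝓝 (f x), e.symm (ψ p, (e (φ x)).2) ∈ φ.target := by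
    refine hin.continuousAt.eventually (φ.open_target.mem_nhds ?_)
    change e.symm (ψ (f x), (e (φ x)).2) ∈ φ.target
    rw [hx0]
    exact φ.map_source hxs
  refine ⟨fun p ↦ φ.symm (e.symm (ψ p, (e (φ x)).2)), ?_, ?_, ?_⟩
  · refine ContMDiffAt.comp (I' := 𝓘(ℝ, E)) (f x) (g := φ.symm) ?_ hin
    rw [hx0]
    exact (hsm _ (φ.map_source hxs)).contMDiffAt (φ.open_target.mem_nhds (φ.map_source hxs))
  · exact (congrArg φ.symm hx0).trans (φ.left_inv hxs)
  · filter_upwards [hev, ψ.open_source.mem_nhds hxt] with p hp hp'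
    have h1 := hw (x := e.symm (ψ p, (e (φ x)).2)) (by simpa using hp)
    have h2 : ψ (f (φ.symm (e.symm (ψ p, (e (φ x)).2)))) = ψ p := by simpa using h1
    exact ψ.injOn (hsub (φ.map_target hp)) hp' h2

theorem Manifold.IsSubmersionAt.mfderiv_surjective {f : M → N} {x : M}
    (hf : Manifold.IsSubmersionAt 𝓘(ℝ, E) 𝓘(ℝ, F) ∞ f x) :
    Function.Surjective (mfderiv 𝓘(ℝ, E) 𝓘(ℝ, F) f x) := by
  obtain ⟨σ, hσ, hx, hev⟩ := hf.exists_local_section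
  have hn : (∞ : ℕ∞ω) ≠ 0 := by simp
  have h1 : MDifferentiableAt 𝓘(ℝ, E) 𝓘(ℝ, F) f (σ (f x)) := by
    rw [hx]
    exact hf.contMDiffAt.mdifferentiableAt hn
  have h2 := (h1.hasMFDerivAt.comp (f x) (hσ.mdifferentiableAt hn).hasMFDerivAt).mfderiv
  have h3 : mfderiv 𝓘(ℝ, F) 𝓘(ℝ, F) (f ∘ σ) (f x) = ContinuousLinearMap.id ℝ _ := by
    rw [← mfderiv_id (I := 𝓘(ℝ, F)) (x := f x)]
    exact EventuallyEq.mfderiv_eq hev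
  intro w
  -- The type of a derivative depends on its base point, so the point is generalized and then
  -- substituted; the other transport lemmas named `key` between equal base points serve the same
  -- purpose.
  have key : ∀ y, y = x → ∀ L : F →L[ℝ] E,
      (mfderiv 𝓘(ℝ, E) 𝓘(ℝ, F) f y : E →L[ℝ] F).comp L = ContinuousLinearMap.id ℝ F →
      ∃ v, (mfderiv 𝓘(ℝ, E) 𝓘(ℝ, F) f x : E →L[ℝ] F) v = w := by
    rintro _ rfl L hL
    exact ⟨L w, congrArg (fun T : F →L[ℝ] F ↦ T w) hL⟩
  exact key _ hx _ (h2.symm.trans h3)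

/-- A vector tangent to the fiber of a submersion is the velocity of a global smooth curve in the
fiber. -/
theorem Manifold.IsSubmersionAt.exists_curve {f : M → N} {x : M}
    (hf : Manifold.IsSubmersionAt 𝓘(ℝ, E) 𝓘(ℝ, F) ∞ f x) {v : E}
    (hv : (mfderiv 𝓘(ℝ, E) 𝓘(ℝ, F) f x : E →L[ℝ] F) v = 0) :
    ∃ γ : ℝ → M, ContMDiff 𝓘(ℝ, ℝ) 𝓘(ℝ, E) ∞ γ ∧ γ 0 = x ∧ (∀ t, f (γ t) = f x) ∧
      v = (mfderiv 𝓘(ℝ, ℝ) 𝓘(ℝ, E) γ 0 : ℝ →L[ℝ] E) 1 := by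
  have hn : (∞ : ℕ∞ω) ≠ 0 := by simp
  have hw := hf.writtenInCharts
  have hxs := hf.mem_domChart_source
  have hxt := hf.mem_codChart_source
  have hdm := contMDiffOn_of_mem_maximalAtlas hf.domChart_mem_maximalAtlas
  have hsm := contMDiffOn_symm_of_mem_maximalAtlas hf.domChart_mem_maximalAtlas
  have hcm := contMDiffOn_of_mem_maximalAtlas hf.codChart_mem_maximalAtlas
  have hsub := hf.source_subset_preimage_source
  have hfx := hf.contMDiffAt
  set φ := hf.domChart
  set ψ := hf.codChart
  set e := hf.equiv
  have hφx : MDifferentiableAt 𝓘(ℝ, E) 𝓘(ℝ, E) φ x :=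
    ((hdm x hxs).contMDiffAt (φ.open_source.mem_nhds hxs)).mdifferentiableAt hn
  have hψx : MDifferentiableAt 𝓘(ℝ, F) 𝓘(ℝ, F) ψ (f x) :=
    ((hcm _ hxt).contMDiffAt (ψ.open_source.mem_nhds hxt)).mdifferentiableAt hn
  let v' : E := (mfderiv 𝓘(ℝ, E) 𝓘(ℝ, E) φ x : E →L[ℝ] E) v
  have heq : ψ ∘ f =ᶠ[𝓝 x] (fun y ↦ (e y).1) ∘ φ := by
    filter_upwards [φ.open_source.mem_nhds hxs] with y hy
    have h1 := hw (x := φ y) (by simpa using φ.map_source hy)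
    simpa [φ.left_inv hy] using h1
  have hlin : HasMFDerivAt 𝓘(ℝ, E) 𝓘(ℝ, F) (fun y : E ↦ (e y).1) (φ x)
      ((ContinuousLinearMap.fst ℝ F hf.complement).comp e.toContinuousLinearMap) :=
    ((ContinuousLinearMap.fst ℝ F hf.complement).comp e.toContinuousLinearMap).hasFDerivAt.hasMFDerivAt
  have hv1 : (e v').1 = 0 := by
    have h1 := (hlin.comp x hφx.hasMFDerivAt).mfderiv
    have h2 := (hψx.hasMFDerivAt.comp x (hfx.mdifferentiableAt hn).hasMFDerivAt).mfderiv
    have h3 := h1.symm.trans (heq.mfderiv_eq.symm.trans h2)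
    have h4 := congrArg (fun T : E →L[ℝ] F ↦ T v) h3
    have h5 : (mfderiv 𝓘(ℝ, F) 𝓘(ℝ, F) ψ (f x) : F →L[ℝ] F)
      ((mfderiv 𝓘(ℝ, E) 𝓘(ℝ, F) f x : E →L[ℝ] F) v) = 0 := by rw [hv, map_zero]
    exact h4.trans h5
  have hcont : Continuous (fun s : ℝ ↦ φ x + s • v') := by fun_prop
  obtain ⟨ε, hε, hball⟩ := Metric.mem_nhds_iff.1 (hcont.continuousAt.preimage_mem_nhds
    (x := (0 : ℝ)) (t := φ.target) (by simpa using φ.open_target.mem_nhds (φ.map_source hxs)))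
  -- A reparametrization with `s 0 = 0`, `s' 0 = 1` and `|s| ≤ ε / 2`: the segment in direction `v'`
  -- stays in the chart for all times, so the curve is defined on all of `ℝ`.
  let s : ℝ → ℝ := fun t ↦ ε / 2 * Real.sin (2 / ε * t)
  have hs : ∀ t, φ x + s t • v' ∈ φ.target := by
    intro t
    refine hball ?_
    rw [Metric.mem_ball, dist_zero_right, Real.norm_eq_abs, abs_mul, abs_of_pos (half_pos hε)]
    have := Real.abs_sin_le_one (2 / ε * t)
    nlinarith
  have hsd : ContDiff ℝ ∞ (fun t ↦ φ x + s t • v') := by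
    have : ContDiff ℝ ∞ s := contDiff_const.mul (Real.contDiff_sin.comp (by fun_prop))
    exact contDiff_const.add (this.smul contDiff_const)
  have hs0 : φ x + s 0 • v' = φ x := by simp [s]
  have hs' : HasDerivAt (fun t ↦ φ x + s t • v') v' 0 := by
    have h1 : HasDerivAt (fun t : ℝ ↦ 2 / ε * t) (2 / ε) 0 := by
      simpa using (hasDerivAt_id (0 : ℝ)).const_mul (2 / ε)
    have h2 := (h1.sin.const_mul (ε / 2)).smul_const v'
    have h3 : ε / 2 * (Real.cos (2 / ε * 0) * (2 / ε)) = 1 := by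
      rw [mul_zero, Real.cos_zero]
      field_simp
    rw [h3, one_smul] at h2
    exact h2.const_add (φ x)
  refine ⟨fun t ↦ φ.symm (φ x + s t • v'), ?_, ?_, fun t ↦ ?_, ?_⟩
  · intro t
    exact ((hsm _ (hs t)).contMDiffAt (φ.open_target.mem_nhds (hs t))).comp t
      hsd.contMDiff.contMDiffAt
  · simp only [hs0, φ.left_inv hxs]
  · have h1 := hw (x := φ x + s t • v') (by simpa using hs t)
    have h2 := hw (x := φ x) (by simpa using φ.map_source hxs)
    have h3 : ψ (f (φ.symm (φ x + s t • v'))) = ψ (f x) := by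
      have h4 : ψ (f (φ.symm (φ x + s t • v'))) = (e (φ x)).1 := by simpa [hv1] using h1
      have h5 : ψ (f x) = (e (φ x)).1 := by simpa [φ.left_inv hxs] using h2
      rw [h4, h5]
    exact ψ.injOn (hsub (φ.map_target (hs t))) hxt h3
  · have hxt' := φ.map_source hxs
    have h1 : HasMFDerivAt 𝓘(ℝ, E) 𝓘(ℝ, E) φ.symm (φ x)
        (mfderiv 𝓘(ℝ, E) 𝓘(ℝ, E) φ.symm (φ x)) :=
      (((hsm _ hxt').contMDiffAt (φ.open_target.mem_nhds hxt')).mdifferentiableAt hn).hasMFDerivAt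
    have h2 : (mfderiv 𝓘(ℝ, E) 𝓘(ℝ, E) φ.symm (φ x) : E →L[ℝ] E) v' = v := by
      have h3 := (h1.comp x hφx.hasMFDerivAt).mfderiv
      have h4 : φ.symm ∘ φ =ᶠ[𝓝 x] id := by
        filter_upwards [φ.open_source.mem_nhds hxs] with y hy
        exact φ.left_inv hy
      have h5 := (h3.symm.trans h4.mfderiv_eq).trans mfderiv_id
      exact congrArg (fun T : E →L[ℝ] E ↦ T v) h5
    rw [← hs0] at h1
    have h6 := (h1.comp (0 : ℝ) hs'.hasFDerivAt.hasMFDerivAt).mfderiv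
    have h7 := congrArg (fun T : ℝ →L[ℝ] E ↦ T 1) h6
    refine Eq.trans ?_ h7.symm
    change v = (mfderiv 𝓘(ℝ, E) 𝓘(ℝ, E) φ.symm (φ x + s 0 • v') : E →L[ℝ] E) ((1 : ℝ) • v')
    rw [hs0, one_smul]
    exact h2.symm

end Submersion

/-! ### Naturality of the Lie bracket for related vector fields. -/

section RelatedVectorFields

open Filter Topology VectorField

variable {E F : Type*} [NormedAddCommGroup E] [NormedSpace ℝ E]
  [NormedAddCommGroup F] [NormedSpace ℝ F]
  {M : Type*} [TopologicalSpace M] [ChartedSpace E M]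
  {N : Type*} [TopologicalSpace N] [ChartedSpace F N]

/-- The expression of a vector field in the preferred chart at `x₀`. -/
def chartField (x₀ : M) (V : Π x : M, TangentSpace 𝓘(ℝ, E) x) (y : E) : E :=
  mfderiv 𝓘(ℝ, E) 𝓘(ℝ, E) (extChartAt 𝓘(ℝ, E) x₀) ((extChartAt 𝓘(ℝ, E) x₀).symm y)
    (V ((extChartAt 𝓘(ℝ, E) x₀).symm y))

theorem mfderiv_extChartAt_symm_chartField [IsManifold 𝓘(ℝ, E) 1 M] {x₀ : M}
    (V : Π x : M, TangentSpace 𝓘(ℝ, E) x) {y : E} (hy : y ∈ (extChartAt 𝓘(ℝ, E) x₀).target) :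
    (mfderiv 𝓘(ℝ, E) 𝓘(ℝ, E) (extChartAt 𝓘(ℝ, E) x₀).symm y : E →L[ℝ] E) (chartField (E := E) x₀ V y) =
      V ((extChartAt 𝓘(ℝ, E) x₀).symm y) := by
  have h := mfderivWithin_extChartAt_symm_comp_mfderiv_extChartAt (I := 𝓘(ℝ, E)) hy
  rw [ModelWithCorners.range_eq_univ, mfderivWithin_univ] at h
  exact congrArg (fun T : E →L[ℝ] E ↦ T (V ((extChartAt 𝓘(ℝ, E) x₀).symm y))) h

/-- The pullback uses the inverse of the derivative of the inverse chart, which is the derivative of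
the chart. -/
theorem mpullbackWithin_eq_chartField [IsManifold 𝓘(ℝ, E) 1 M] {x₀ : M}
    (V : Π x : M, TangentSpace 𝓘(ℝ, E) x) {y : E} (hy : y ∈ (extChartAt 𝓘(ℝ, E) x₀).target) :
    mpullbackWithin 𝓘(ℝ, E) 𝓘(ℝ, E) (extChartAt 𝓘(ℝ, E) x₀).symm V (Set.range 𝓘(ℝ, E)) y =
      chartField x₀ V y := by
  rw [mpullbackWithin_apply]
  have h := ContinuousLinearMap.inverse_eq
    (mfderivWithin_extChartAt_symm_comp_mfderiv_extChartAt (I := 𝓘(ℝ, E)) hy)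
    (mfderiv_extChartAt_comp_mfderivWithin_extChartAt_symm hy)
  rw [h]
  rfl

theorem eventuallyEq_chartField [IsManifold 𝓘(ℝ, E) 1 M] (x₀ : M)
    (V : Π x : M, TangentSpace 𝓘(ℝ, E) x) :
    mpullbackWithin 𝓘(ℝ, E) 𝓘(ℝ, E) (extChartAt 𝓘(ℝ, E) x₀).symm V (Set.range 𝓘(ℝ, E))
      =ᶠ[𝓝 (extChartAt 𝓘(ℝ, E) x₀ x₀)] chartField x₀ V := by
  filter_upwards [extChartAt_target_mem_nhds (I := 𝓘(ℝ, E)) x₀] with y hy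
  exact mpullbackWithin_eq_chartField V hy

theorem mlieBracket_eq_lieBracket_chartField [IsManifold 𝓘(ℝ, E) 1 M] (x₀ : M)
    (V W : Π x : M, TangentSpace 𝓘(ℝ, E) x) :
    mlieBracket 𝓘(ℝ, E) V W x₀ =
      lieBracket ℝ (chartField x₀ V) (chartField x₀ W) (extChartAt 𝓘(ℝ, E) x₀ x₀) := by
  rw [← mlieBracketWithin_univ, mlieBracketWithin_apply]
  have key : ∀ T : E →L[ℝ] E, T = ContinuousLinearMap.id ℝ E → ∀ w, T.inverse w = w := by
    rintro _ rfl w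
    rw [ContinuousLinearMap.inverse_id, ContinuousLinearMap.id_apply]
  refine (key _ mfderiv_extChartAt_self _).trans ?_
  have hs : (extChartAt 𝓘(ℝ, E) x₀).symm ⁻¹' Set.univ ∩ Set.range 𝓘(ℝ, E) = Set.univ := by simp
  rw [hs]
  refine (congrFun lieBracketWithin_univ _).trans ?_
  exact (eventuallyEq_chartField x₀ V).lieBracket_vectorField_eq (eventuallyEq_chartField x₀ W)

theorem MDifferentiableAt.differentiableAt_chartField [CompleteSpace E] [IsManifold 𝓘(ℝ, E) 2 M]
    {x₀ : M}
    {V : Π x : M, TangentSpace 𝓘(ℝ, E) x} (hV : MDifferentiableAt 𝓘(ℝ, E) 𝓘(ℝ, E).tangent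
      (fun x ↦ (⟨x, V x⟩ : TangentBundle 𝓘(ℝ, E) M)) x₀) :
    DifferentiableAt ℝ (chartField x₀ V) (extChartAt 𝓘(ℝ, E) x₀ x₀) := by
  have : IsManifold 𝓘(ℝ, E) 1 M := IsManifold.of_le (n := 2) one_le_two
  have h := MDifferentiableWithinAt.differentiableWithinAt_mpullbackWithin_vectorField
    (s := Set.univ) hV.mdifferentiableWithinAt
  rw [Set.preimage_univ, Set.univ_inter] at h
  nth_rewrite 2 [ModelWithCorners.range_eq_univ] at h
  exact (differentiableWithinAt_univ.1 h).congr_of_eventuallyEq (eventuallyEq_chartField x₀ V).symm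

/-- Related vector fields are related in charts. -/
theorem fderiv_chart_chartField [IsManifold 𝓘(ℝ, E) 1 M] [IsManifold 𝓘(ℝ, F) 1 N]
    {f : M → N} {x₀ : M} {V : Π x : M, TangentSpace 𝓘(ℝ, E) x}
    {V' : Π x : N, TangentSpace 𝓘(ℝ, F) x} {y : E}
    (hy : y ∈ (extChartAt 𝓘(ℝ, E) x₀).target)
    (hf : MDifferentiableAt 𝓘(ℝ, E) 𝓘(ℝ, F) f ((extChartAt 𝓘(ℝ, E) x₀).symm y))
    (hy' : f ((extChartAt 𝓘(ℝ, E) x₀).symm y) ∈ (extChartAt 𝓘(ℝ, F) (f x₀)).source)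
    (hV : mfderiv 𝓘(ℝ, E) 𝓘(ℝ, F) f ((extChartAt 𝓘(ℝ, E) x₀).symm y)
      (V ((extChartAt 𝓘(ℝ, E) x₀).symm y)) = V' (f ((extChartAt 𝓘(ℝ, E) x₀).symm y))) :
    fderiv ℝ (extChartAt 𝓘(ℝ, F) (f x₀) ∘ f ∘ (extChartAt 𝓘(ℝ, E) x₀).symm) y
        (chartField x₀ V y) =
      chartField (f x₀) V' (extChartAt 𝓘(ℝ, F) (f x₀) (f ((extChartAt 𝓘(ℝ, E) x₀).symm y))) := by
  have h1 : MDifferentiableAt 𝓘(ℝ, E) 𝓘(ℝ, E) (extChartAt 𝓘(ℝ, E) x₀).symm y := by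
    have := mdifferentiableWithinAt_extChartAt_symm hy
    rwa [ModelWithCorners.range_eq_univ, mdifferentiableWithinAt_univ] at this
  have h2 := mdifferentiableAt_extChartAt (I := 𝓘(ℝ, F)) (by simpa using hy')
  have h3 := ((h2.hasMFDerivAt.comp _ hf.hasMFDerivAt).comp y h1.hasMFDerivAt).mfderiv
  rw [← mfderiv_eq_fderiv]
  have h4 := congrArg (fun T : E →L[ℝ] F ↦ T (chartField x₀ V y)) h3
  refine h4.trans ?_
  have h5 := mfderiv_extChartAt_symm_chartField V hy
  change mfderiv 𝓘(ℝ, F) 𝓘(ℝ, F) (extChartAt 𝓘(ℝ, F) (f x₀)) _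
    (mfderiv 𝓘(ℝ, E) 𝓘(ℝ, F) f _
      ((mfderiv 𝓘(ℝ, E) 𝓘(ℝ, E) (extChartAt 𝓘(ℝ, E) x₀).symm y : E →L[ℝ] E) (chartField (E := E) x₀ V y))) = _
  rw [h5, hV, chartField, PartialEquiv.left_inv _ hy']

/-- The Lie bracket of vector fields is natural with respect to smooth maps. -/
theorem mlieBracket_eq_mfderiv_mlieBracket [CompleteSpace E] [CompleteSpace F]
    [IsManifold 𝓘(ℝ, E) 2 M] [IsManifold 𝓘(ℝ, F) 2 N]
    {f : M → N} {x₀ : M} (hf : ContMDiff 𝓘(ℝ, E) 𝓘(ℝ, F) 2 f)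
    {V W : Π x : M, TangentSpace 𝓘(ℝ, E) x} {V' W' : Π x : N, TangentSpace 𝓘(ℝ, F) x}
    (hV : MDifferentiableAt 𝓘(ℝ, E) 𝓘(ℝ, E).tangent
      (fun x ↦ (⟨x, V x⟩ : TangentBundle 𝓘(ℝ, E) M)) x₀)
    (hW : MDifferentiableAt 𝓘(ℝ, E) 𝓘(ℝ, E).tangent
      (fun x ↦ (⟨x, W x⟩ : TangentBundle 𝓘(ℝ, E) M)) x₀)
    (hV' : MDifferentiableAt 𝓘(ℝ, F) 𝓘(ℝ, F).tangent
      (fun x ↦ (⟨x, V' x⟩ : TangentBundle 𝓘(ℝ, F) N)) (f x₀))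
    (hW' : MDifferentiableAt 𝓘(ℝ, F) 𝓘(ℝ, F).tangent
      (fun x ↦ (⟨x, W' x⟩ : TangentBundle 𝓘(ℝ, F) N)) (f x₀))
    (hVV' : ∀ x, mfderiv 𝓘(ℝ, E) 𝓘(ℝ, F) f x (V x) = V' (f x))
    (hWW' : ∀ x, mfderiv 𝓘(ℝ, E) 𝓘(ℝ, F) f x (W x) = W' (f x)) :
    mlieBracket 𝓘(ℝ, F) V' W' (f x₀) =
      mfderiv 𝓘(ℝ, E) 𝓘(ℝ, F) f x₀ (mlieBracket 𝓘(ℝ, E) V W x₀) := by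
  have : IsManifold 𝓘(ℝ, E) 1 M := IsManifold.of_le (n := 2) one_le_two
  have : IsManifold 𝓘(ℝ, F) 1 N := IsManifold.of_le (n := 2) one_le_two
  have hdf := hf.mdifferentiable two_ne_zero
  set y₀ := extChartAt 𝓘(ℝ, E) x₀ x₀ with hy₀
  set f' := extChartAt 𝓘(ℝ, F) (f x₀) ∘ f ∘ (extChartAt 𝓘(ℝ, E) x₀).symm with hf'
  have hx₀ : (extChartAt 𝓘(ℝ, E) x₀).symm y₀ = x₀ := extChartAt_to_inv x₀
  have hf'y₀ : f' y₀ = extChartAt 𝓘(ℝ, F) (f x₀) (f x₀) := by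
    simp only [hf', Function.comp_apply, hx₀]
  have hcd : ContDiffAt ℝ 2 f' y₀ := by
    have h := (contMDiffAt_iff.1 (hf x₀)).2
    rw [ModelWithCorners.range_eq_univ, contDiffWithinAt_univ] at h
    exact h
  -- Relatedness in charts, `Df'(V) = V' ∘ f'`, holds on a neighbourhood, so it may be
  -- differentiated.
  have hev : ∀ {V : Π x : M, TangentSpace 𝓘(ℝ, E) x} {V' : Π x : N, TangentSpace 𝓘(ℝ, F) x},
      (∀ x, mfderiv 𝓘(ℝ, E) 𝓘(ℝ, F) f x (V x) = V' (f x)) →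
      (fun y ↦ fderiv ℝ f' y (chartField x₀ V y)) =ᶠ[𝓝 y₀] chartField (f x₀) V' ∘ f' := by
    intro V V' h
    have h1 : ∀ᶠ y in 𝓝 y₀, f ((extChartAt 𝓘(ℝ, E) x₀).symm y) ∈
        (extChartAt 𝓘(ℝ, F) (f x₀)).source := by
      have hc : ContinuousAt (f ∘ (extChartAt 𝓘(ℝ, E) x₀).symm) y₀ :=
        hf.continuous.continuousAt.comp (continuousAt_extChartAt_symm x₀)
      refine hc.eventually ((isOpen_extChartAt_source _).mem_nhds ?_)
      rw [Function.comp_apply, hx₀]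
      exact mem_extChartAt_source _
    filter_upwards [extChartAt_target_mem_nhds (I := 𝓘(ℝ, E)) x₀, h1] with y hy hy'
    exact fderiv_chart_chartField hy (hdf _) hy' (h _)
  have hder : ∀ {V' : Π x : N, TangentSpace 𝓘(ℝ, F) x},
      MDifferentiableAt 𝓘(ℝ, F) 𝓘(ℝ, F).tangent
      (fun x ↦ (⟨x, V' x⟩ : TangentBundle 𝓘(ℝ, F) N)) (f x₀) → ∀ v,
      fderiv ℝ (chartField (f x₀) V' ∘ f') y₀ v =
        fderiv ℝ (chartField (f x₀) V') (f' y₀) (fderiv ℝ f' y₀ v) := by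
    intro V' h v
    rw [fderiv_comp _ (hf'y₀ ▸ h.differentiableAt_chartField)
      (hcd.differentiableAt two_ne_zero)]
    rfl
  have hval : ∀ {V : Π x : M, TangentSpace 𝓘(ℝ, E) x} {V' : Π x : N, TangentSpace 𝓘(ℝ, F) x},
      (∀ x, mfderiv 𝓘(ℝ, E) 𝓘(ℝ, F) f x (V x) = V' (f x)) →
      fderiv ℝ f' y₀ (chartField x₀ V y₀) = chartField (f x₀) V' (f' y₀) :=
    fun h ↦ (hev h).eq_of_nhds
  -- The second derivative of `f'` is symmetric and drops out of the bracket. Invertibility of `Df'`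
  -- is not needed, which matters for orbit maps.
  have main := fderiv_apply_lieBracket hcd (by simp) hW.differentiableAt_chartField
    hV.differentiableAt_chartField
  rw [(hev hWW').fderiv_eq, (hev hVV').fderiv_eq, hder hW', hder hV', hval hVV', hval hWW'] at main
  rw [mlieBracket_eq_lieBracket_chartField, mlieBracket_eq_lieBracket_chartField, ← hf'y₀, ← hy₀]
  refine main.symm.trans ?_
  have hmf : (mfderiv 𝓘(ℝ, E) 𝓘(ℝ, F) f x₀ : E →L[ℝ] F) = fderiv ℝ f' y₀ := by
    have h := (hdf x₀).mfderiv
    rw [ModelWithCorners.range_eq_univ, fderivWithin_univ] at h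
    exact h
  exact (congrArg (fun T : E →L[ℝ] F ↦ T _) hmf).symm

end RelatedVectorFields

/-! ### The action on the quotient and its fundamental fields. -/

section FundamentalFields

open Filter Topology VectorField Bundle

variable {E F : Type*} [NormedAddCommGroup E] [NormedSpace ℝ E]
  [NormedAddCommGroup F] [NormedSpace ℝ F]
  {G : Type*} [TopologicalSpace G] [ChartedSpace E G] [Group G]
  {M : Type*} [TopologicalSpace M] [ChartedSpace F M] [MulAction G M]

theorem contMDiff_smul_left
    (hact : ContMDiff (𝓘(ℝ, E).prod 𝓘(ℝ, F)) 𝓘(ℝ, F) ∞ (fun p : G × M ↦ p.1 • p.2)) (q : M) :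
    ContMDiff 𝓘(ℝ, E) 𝓘(ℝ, F) ∞ (fun a : G ↦ a • q) :=
  hact.comp (contMDiff_id.prodMk contMDiff_const)

theorem contMDiff_const_smul_action
    (hact : ContMDiff (𝓘(ℝ, E).prod 𝓘(ℝ, F)) 𝓘(ℝ, F) ∞ (fun p : G × M ↦ p.1 • p.2)) (a : G) :
    ContMDiff 𝓘(ℝ, F) 𝓘(ℝ, F) ∞ (fun q : M ↦ a • q) :=
  hact.comp (contMDiff_const.prodMk contMDiff_id)

variable [LieGroup 𝓘(ℝ, E) ∞ G]

/-- With a local section `σ` of the projection, `(a, p) ↦ a • p` is locally the projection of `a * σ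
p`. -/
theorem contMDiff_smul_quotient {H : Subgroup G} [ChartedSpace F (G ⧸ H)]
    (hproj : Manifold.IsSubmersion 𝓘(ℝ, E) 𝓘(ℝ, F) ∞ (fun a : G ↦ (a : G ⧸ H))) :
    ContMDiff (𝓘(ℝ, E).prod 𝓘(ℝ, F)) 𝓘(ℝ, F) ∞ (fun p : G × (G ⧸ H) ↦ p.1 • p.2) := by
  rintro ⟨a, p⟩
  obtain ⟨b, rfl⟩ := QuotientGroup.mk_surjective p
  obtain ⟨σ, hσ, -, hev⟩ := (hproj.isSubmersionAt b).exists_local_section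
  have h1 : ContMDiffAt (𝓘(ℝ, E).prod 𝓘(ℝ, F)) 𝓘(ℝ, E) ∞
      (fun p : G × (G ⧸ H) ↦ p.1 * σ p.2) (a, (b : G ⧸ H)) :=
    contMDiffAt_fst.mul (ContMDiffAt.comp (I' := 𝓘(ℝ, F)) (a, (b : G ⧸ H)) hσ contMDiffAt_snd)
  have h2 := (hproj.contMDiff _).comp _ h1
  refine h2.congr_of_eventuallyEq ?_
  have h3 : ∀ᶠ p : G × (G ⧸ H) in 𝓝 (a, (b : G ⧸ H)), ((σ p.2 : G) : G ⧸ H) = p.2 :=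
    (continuous_snd.tendsto (a, (b : G ⧸ H))).eventually hev
  filter_upwards [h3] with p hp
  conv_lhs => rw [← hp]
  rfl

/-- The fundamental vector field of an action, associated to an element of the Lie algebra. -/
def fundamentalField (X : GroupLieAlgebra 𝓘(ℝ, E) G) (p : M) : TangentSpace 𝓘(ℝ, F) p :=
  (mfderiv 𝓘(ℝ, E) 𝓘(ℝ, F) (fun a : G ↦ a • p) 1 : E →L[ℝ] F) X

theorem isSmoothVF_fundamentalField [IsManifold 𝓘(ℝ, F) ∞ M]
    (hact : ContMDiff (𝓘(ℝ, E).prod 𝓘(ℝ, F)) 𝓘(ℝ, F) ∞ (fun p : G × M ↦ p.1 • p.2))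
    (X : GroupLieAlgebra 𝓘(ℝ, E) G) :
    IsSmoothVF (fundamentalField (F := F) (M := M) X) := by
  have hn : (∞ : ℕ∞ω) ≠ 0 := by simp
  let fg : M → TangentBundle 𝓘(ℝ, F) M := fun p ↦ TotalSpace.mk' F p 0
  have sfg : ContMDiff 𝓘(ℝ, F) 𝓘(ℝ, F).tangent ∞ fg := contMDiff_zeroSection _ _
  let fv : M → TangentBundle 𝓘(ℝ, E) G := fun _ ↦ TotalSpace.mk' E 1 X
  have sfv : ContMDiff 𝓘(ℝ, F) 𝓘(ℝ, E).tangent ∞ fv := contMDiff_const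
  have S₁ := sfv.prodMk sfg
  have S₂ : ContMDiff (𝓘(ℝ, E).tangent.prod 𝓘(ℝ, F).tangent) (𝓘(ℝ, E).prod 𝓘(ℝ, F)).tangent ∞
      (equivTangentBundleProd 𝓘(ℝ, E) G 𝓘(ℝ, F) M).symm := contMDiff_equivTangentBundleProd_symm
  have S₃ : ContMDiff (𝓘(ℝ, E).prod 𝓘(ℝ, F)).tangent 𝓘(ℝ, F).tangent ∞
      (tangentMap (𝓘(ℝ, E).prod 𝓘(ℝ, F)) 𝓘(ℝ, F) (fun p : G × M ↦ p.1 • p.2)) :=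
    hact.contMDiff_tangentMap (m := ∞) le_rfl
  have S := (S₃.comp S₂).comp S₁
  -- The fundamental field is the image of `(X, 0)`, based at `(1, p)`, under the tangent map of the
  -- action.
  have hS : (fun p : M ↦ (⟨p, fundamentalField X p⟩ : TangentBundle 𝓘(ℝ, F) M)) =
      (tangentMap (𝓘(ℝ, E).prod 𝓘(ℝ, F)) 𝓘(ℝ, F) (fun p : G × M ↦ p.1 • p.2) ∘
        (equivTangentBundleProd 𝓘(ℝ, E) G 𝓘(ℝ, F) M).symm) ∘ fun p ↦ (fv p, fg p) := by
    funext p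
    have h1 := mfderiv_prod_eq_add_apply (hact.mdifferentiable hn ((1 : G), p))
      (v := ((X, (0 : F)) : E × F))
    refine TotalSpace.ext (one_smul G p).symm (heq_of_eq ?_)
    refine Eq.trans ?_ h1.symm
    have h2 : (mfderiv 𝓘(ℝ, F) 𝓘(ℝ, F) (fun q : M ↦ ((1 : G) • q : M)) p : F →L[ℝ] F) 0 = 0 :=
      map_zero _
    let w₀ : F := fundamentalField X p
    exact ((congrArg (fun w : F ↦ w₀ + w) h2).trans (add_zero w₀)).symm
  unfold IsSmoothVF
  rw [hS]
  exact S

/-- Differentiate `a * a⁻¹ = 1` at the unit. -/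
theorem mfderiv_inv_one (X : GroupLieAlgebra 𝓘(ℝ, E) G) :
    (mfderiv 𝓘(ℝ, E) 𝓘(ℝ, E) (fun a : G ↦ a⁻¹) 1 : E →L[ℝ] E) X = -X := by
  have hn : (∞ : ℕ∞ω) ≠ 0 := by simp
  have hm : MDifferentiable (𝓘(ℝ, E).prod 𝓘(ℝ, E)) 𝓘(ℝ, E) (fun p : G × G ↦ p.1 * p.2) :=
    (contMDiff_mul 𝓘(ℝ, E) ∞).mdifferentiable hn
  have hi : MDifferentiable 𝓘(ℝ, E) 𝓘(ℝ, E) (fun a : G ↦ a⁻¹) :=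
    (contMDiff_inv 𝓘(ℝ, E) ∞).mdifferentiable hn
  have h1 := ((hm ((1 : G), (1 : G)⁻¹)).hasMFDerivAt.comp (1 : G)
    ((hasMFDerivAt_id (I := 𝓘(ℝ, E)) (1 : G)).prodMk (hi 1).hasMFDerivAt)).mfderiv
  have h2 : ((fun p : G × G ↦ p.1 * p.2) ∘ fun a : G ↦ (id a, a⁻¹)) = fun _ ↦ 1 := by
    ext a
    simp
  have h3 : mfderiv 𝓘(ℝ, E) 𝓘(ℝ, E)
      ((fun p : G × G ↦ p.1 * p.2) ∘ fun a : G ↦ (id a, a⁻¹)) 1 = 0 := by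
    rw [h2]
    exact mfderiv_const
  have h4 := congrArg (fun T : E →L[ℝ] E ↦ T X) (h1.symm.trans h3)
  have h5 := (mfderiv_prod_eq_add_apply (hm ((1 : G), (1 : G)⁻¹))
    (v := ((X, (mfderiv 𝓘(ℝ, E) 𝓘(ℝ, E) (fun a : G ↦ a⁻¹) 1 : E →L[ℝ] E) X) : E × E))).symm.trans h4
  have key : ∀ (f : G → G) (u : E), f = id →
      (mfderiv 𝓘(ℝ, E) 𝓘(ℝ, E) f 1 : E →L[ℝ] E) u = u := by
    rintro _ u rfl
    rw [mfderiv_id]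
    rfl
  have key' : ∀ (f : G → G) (b : G) (u : E), f = id → b = 1 →
      (mfderiv 𝓘(ℝ, E) 𝓘(ℝ, E) f b : E →L[ℝ] E) u = u := by
    rintro _ _ u rfl rfl
    rw [mfderiv_id]
    rfl
  have h6 := congrArg₂ (fun x y : E ↦ x + y) (key (fun z ↦ z * (1 : G)⁻¹) X (by ext; simp))
    (key' (fun z ↦ 1 * z) (1 : G)⁻¹
      ((mfderiv 𝓘(ℝ, E) 𝓘(ℝ, E) (fun a : G ↦ a⁻¹) 1 : E →L[ℝ] E) X) (by ext; simp) (by simp))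
  let D : E →L[ℝ] E := mfderiv 𝓘(ℝ, E) 𝓘(ℝ, E) (fun a : G ↦ a⁻¹) 1
  let X' : E := X
  have h7 : X' + D X' = 0 := h6.symm.trans h5
  exact eq_neg_of_add_eq_zero_right h7

theorem contMDiff_inv_smul
    (hact : ContMDiff (𝓘(ℝ, E).prod 𝓘(ℝ, F)) 𝓘(ℝ, F) ∞ (fun p : G × M ↦ p.1 • p.2)) (q : M) :
    ContMDiff 𝓘(ℝ, E) 𝓘(ℝ, F) ∞ (fun a : G ↦ a⁻¹ • q) :=
  hact.comp ((contMDiff_inv 𝓘(ℝ, E) ∞).prodMk contMDiff_const)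

theorem mfderiv_inv_smul_one
    (hact : ContMDiff (𝓘(ℝ, E).prod 𝓘(ℝ, F)) 𝓘(ℝ, F) ∞ (fun p : G × M ↦ p.1 • p.2))
    (X : GroupLieAlgebra 𝓘(ℝ, E) G) (q : M) :
    (mfderiv 𝓘(ℝ, E) 𝓘(ℝ, F) (fun a : G ↦ a⁻¹ • q) 1 : E →L[ℝ] F) X = -fundamentalField X q := by
  have hn : (∞ : ℕ∞ω) ≠ 0 := by simp
  have h1 := (((contMDiff_smul_left hact q).mdifferentiable hn (1 : G)⁻¹).hasMFDerivAt.comp (1 : G)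
    ((contMDiff_inv 𝓘(ℝ, E) ∞).mdifferentiable hn (1 : G)).hasMFDerivAt).mfderiv
  have h2 := congrArg (fun T : E →L[ℝ] F ↦ T X) h1
  refine h2.trans ?_
  change (mfderiv 𝓘(ℝ, E) 𝓘(ℝ, F) (fun a : G ↦ a • q) (1 : G)⁻¹ : E →L[ℝ] F)
    ((mfderiv 𝓘(ℝ, E) 𝓘(ℝ, E) (fun a : G ↦ a⁻¹) 1 : E →L[ℝ] E) X) = _
  rw [mfderiv_inv_one, inv_one]
  exact map_neg (mfderiv 𝓘(ℝ, E) 𝓘(ℝ, F) (fun a : G ↦ a • q) (1 : G) : E →L[ℝ] F) X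

/-- Left-invariant fields are related to fundamental fields by `a ↦ a⁻¹ • q`. -/
theorem mfderiv_inv_smul_mulInvariantVectorField
    (hact : ContMDiff (𝓘(ℝ, E).prod 𝓘(ℝ, F)) 𝓘(ℝ, F) ∞ (fun p : G × M ↦ p.1 • p.2))
    (X : GroupLieAlgebra 𝓘(ℝ, E) G) (q : M) (a : G) :
    mfderiv 𝓘(ℝ, E) 𝓘(ℝ, F) (fun a : G ↦ a⁻¹ • q) a (mulInvariantVectorField X a) =
      -fundamentalField X (a⁻¹ • q) := by
  have hn : (∞ : ℕ∞ω) ≠ 0 := by simp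
  have hl : ContMDiff 𝓘(ℝ, E) 𝓘(ℝ, E) ∞ (fun b : G ↦ a * b) := contMDiff_mul_left
  have h1 := (((contMDiff_inv_smul hact q).mdifferentiable hn (a * 1)).hasMFDerivAt.comp (1 : G)
    (hl.mdifferentiable hn (1 : G)).hasMFDerivAt).mfderiv
  -- From `(a b)⁻¹ q = b⁻¹ (a⁻¹ q)`, the derivative at `a` along a left-invariant field becomes a
  -- derivative at `1` for the point `a⁻¹ q`.
  have h2 : (fun a : G ↦ a⁻¹ • q) ∘ (fun b : G ↦ a * b) = fun b : G ↦ b⁻¹ • (a⁻¹ • q) := by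
    ext b
    simp [mul_smul]
  rw [h2] at h1
  have h3 := congrArg (fun T : E →L[ℝ] F ↦ T X) h1
  have h4 := h3.symm.trans (mfderiv_inv_smul_one hact X (a⁻¹ • q))
  have key : ∀ (b : G) (u : E) (w : F), b = a →
      (mfderiv 𝓘(ℝ, E) 𝓘(ℝ, F) (fun a : G ↦ a⁻¹ • q) b : E →L[ℝ] F) u = w →
      (mfderiv 𝓘(ℝ, E) 𝓘(ℝ, F) (fun a : G ↦ a⁻¹ • q) a : E →L[ℝ] F) u = w := by
    rintro _ u w rfl h
    exact h
  exact key _ _ _ (mul_one a) h4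

end FundamentalFields

/-! ### The derivative of `Ad` at the unit is `ad`. -/

section AdjointDerivative

open Filter Topology VectorField

variable {E : Type*} [NormedAddCommGroup E] [NormedSpace ℝ E]

/-- The derivative of `u`, when `∂₂m(x, y₀) X = ∂₁m(y₀, x) u(x)`, for a smooth product `m` with
unit `y₀`. -/
theorem fderiv_eq_lieBracket_of_mul {m : E × E → E} {y₀ : E} (hm : ContDiffAt ℝ 2 m (y₀, y₀))
    (hl : ∀ v, fderiv ℝ m (y₀, y₀) (v, 0) = v) (hr : ∀ v, fderiv ℝ m (y₀, y₀) (0, v) = v)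
    {u : E → E} {X : E} (hu : DifferentiableAt ℝ u y₀) (hu₀ : u y₀ = X)
    (h : (fun x ↦ fderiv ℝ m (x, y₀) (0, X)) =ᶠ[𝓝 y₀] fun x ↦ fderiv ℝ m (y₀, x) (u x, 0))
    (Z : E) :
    fderiv ℝ u y₀ Z = lieBracket ℝ (fun x ↦ fderiv ℝ m (x, y₀) (0, Z))
      (fun x ↦ fderiv ℝ m (x, y₀) (0, X)) y₀ := by
  have hD : DifferentiableAt ℝ (fderiv ℝ m) (y₀, y₀) :=
    (hm.fderiv_right (m := 1) (by norm_num)).differentiableAt one_ne_zero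
  have hD2 := hD.hasFDerivAt
  have hsymm : IsSymmSndFDerivAt ℝ m (y₀, y₀) := hm.isSymmSndFDerivAt (by simp)
  have hleft : HasFDerivAt (fun x : E ↦ fderiv ℝ m (x, y₀))
      ((fderiv ℝ (fderiv ℝ m) (y₀, y₀)).comp (ContinuousLinearMap.inl ℝ E E)) y₀ :=
    HasFDerivAt.comp (f := fun x ↦ (x, y₀)) y₀ hD2 (hasFDerivAt_prodMk_left y₀ y₀)
  have hright : HasFDerivAt (fun x : E ↦ fderiv ℝ m (y₀, x))
      ((fderiv ℝ (fderiv ℝ m) (y₀, y₀)).comp (ContinuousLinearMap.inr ℝ E E)) y₀ :=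
    hD2.comp y₀ (hasFDerivAt_prodMk_right y₀ y₀)
  have h1 : ∀ X Z : E, fderiv ℝ (fun x ↦ fderiv ℝ m (x, y₀) (0, X)) y₀ Z =
      fderiv ℝ (fderiv ℝ m) (y₀, y₀) (Z, 0) (0, X) := by
    intro X Z
    have := (hleft.clm_apply (hasFDerivAt_const ((0 : E), X) y₀)).fderiv
    rw [this]
    simp
  have h2 : fderiv ℝ (fun x ↦ fderiv ℝ m (y₀, x) (u x, 0)) y₀ Z =
      fderiv ℝ (fderiv ℝ m) (y₀, y₀) (0, Z) (X, 0) + fderiv ℝ u y₀ Z := by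
    have hu' : HasFDerivAt (fun x ↦ (u x, (0 : E)))
        ((ContinuousLinearMap.inl ℝ E E).comp (fderiv ℝ u y₀)) y₀ :=
      (ContinuousLinearMap.inl ℝ E E).hasFDerivAt.comp y₀ hu.hasFDerivAt
    have := (hright.clm_apply hu').fderiv
    rw [this]
    simp [hl, hu₀, add_comm]
  rw [lieBracket_eq]
  simp only [hr, h1]
  -- Differentiating `h` along `Z` gives `D²m((Z,0),(0,X)) = D²m((0,Z),(X,0)) + Du(Z)`. By symmetry
  -- the middle term is the derivative along `X` of the left-invariant field of `Z`, so `Du(Z)` is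
  -- the bracket.
  have h3 := h1 X Z
  rw [h.fderiv_eq, h2, hsymm.eq] at h3
  rw [← h3]
  abel

variable {G : Type*} [TopologicalSpace G] [ChartedSpace E G] [Group G]

/-- The derivative at `1` of a map `L : G → G`, in the chart at `1`. -/
theorem mfderiv_chart_mfderiv_one [IsManifold 𝓘(ℝ, E) 1 G] {L : G → G} {a : G}
    (hL : MDifferentiableAt 𝓘(ℝ, E) 𝓘(ℝ, E) L 1) (hLa : L 1 = a)
    (ha : a ∈ (chartAt E (1 : G)).source) (X : E) :
    (mfderiv 𝓘(ℝ, E) 𝓘(ℝ, E) (extChartAt 𝓘(ℝ, E) (1 : G)) a : E →L[ℝ] E)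
      ((mfderiv 𝓘(ℝ, E) 𝓘(ℝ, E) L 1 : E →L[ℝ] E) X) =
      fderiv ℝ (extChartAt 𝓘(ℝ, E) (1 : G) ∘ L ∘ (extChartAt 𝓘(ℝ, E) (1 : G)).symm)
        (extChartAt 𝓘(ℝ, E) (1 : G) 1) X := by
  subst hLa
  have h1 := mdifferentiableAt_extChartAt (I := 𝓘(ℝ, E)) ha
  have h2 := (h1.hasMFDerivAt.comp (1 : G) hL.hasMFDerivAt).mfderiv
  have h3 := (h1.comp (1 : G) hL).mfderiv
  rw [ModelWithCorners.range_eq_univ, fderivWithin_univ] at h3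
  exact congrArg (fun T : E →L[ℝ] E ↦ T X) (h2.symm.trans h3)

/-- A map of two variables in `G`, read in the chart at `1`. -/
def chartMap₂ (c : G × G → G) (p : E × E) : E :=
  extChartAt 𝓘(ℝ, E) (1 : G) (c ((extChartAt 𝓘(ℝ, E) (1 : G)).symm p.1,
    (extChartAt 𝓘(ℝ, E) (1 : G)).symm p.2))

theorem fderiv_chartMap₂_right {c : G × G → G} {x y₀ : E}
    (hc : DifferentiableAt ℝ (chartMap₂ (E := E) c) (x, y₀)) (X : E) :
    fderiv ℝ (chartMap₂ (E := E) c) (x, y₀) (0, X) =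
      fderiv ℝ (fun y ↦ chartMap₂ (E := E) c (x, y)) y₀ X := by
  have := (hc.hasFDerivAt.comp y₀ (hasFDerivAt_prodMk_right x y₀)).fderiv
  exact (congrArg (fun T : E →L[ℝ] E ↦ T X) this).symm

theorem fderiv_chartMap₂_left {c : G × G → G} {x y₀ : E}
    (hc : DifferentiableAt ℝ (chartMap₂ (E := E) c) (y₀, x)) (X : E) :
    fderiv ℝ (chartMap₂ (E := E) c) (y₀, x) (X, 0) =
      fderiv ℝ (fun y ↦ chartMap₂ (E := E) c (y, x)) y₀ X := by
  have := (HasFDerivAt.comp (f := fun y ↦ (y, x)) y₀ hc.hasFDerivAt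
    (hasFDerivAt_prodMk_left y₀ x)).fderiv
  exact (congrArg (fun T : E →L[ℝ] E ↦ T X) this).symm

/-- `Ad(a) X` as a vector of the model space. -/
def groupAdVec (X : E) (a : G) : E := groupAd (E := E) a X

theorem groupAdVec_one (X : E) : groupAdVec X (1 : G) = X := by
  have key : ∀ (f : G → G) (u : E), f = id →
      (mfderiv 𝓘(ℝ, E) 𝓘(ℝ, E) f 1 : E →L[ℝ] E) u = u := by
    rintro _ u rfl
    rw [mfderiv_id]
    rfl
  exact key (fun a ↦ 1 * a * 1⁻¹) X (by ext; simp)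

variable [LieGroup 𝓘(ℝ, E) ∞ G]

theorem contDiffAt_chartMap₂ {c : G × G → G}
    (hc : ContMDiff (𝓘(ℝ, E).prod 𝓘(ℝ, E)) 𝓘(ℝ, E) ∞ c) (h1 : c (1, 1) = 1) :
    ContDiffAt ℝ ∞ (chartMap₂ (E := E) c)
      (extChartAt 𝓘(ℝ, E) (1 : G) 1, extChartAt 𝓘(ℝ, E) (1 : G) 1) := by
  set y₀ := extChartAt 𝓘(ℝ, E) (1 : G) 1
  have hs : ContMDiffAt 𝓘(ℝ, E) 𝓘(ℝ, E) ∞ (extChartAt 𝓘(ℝ, E) (1 : G)).symm y₀ :=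
    (contMDiffOn_extChartAt_symm (1 : G)).contMDiffAt (extChartAt_target_mem_nhds (1 : G))
  have hinv : (extChartAt 𝓘(ℝ, E) (1 : G)).symm y₀ = 1 := extChartAt_to_inv _
  have hp : ContMDiffAt 𝓘(ℝ, E × E) (𝓘(ℝ, E).prod 𝓘(ℝ, E)) ∞ (fun p : E × E ↦
      ((extChartAt 𝓘(ℝ, E) (1 : G)).symm p.1, (extChartAt 𝓘(ℝ, E) (1 : G)).symm p.2)) (y₀, y₀) :=
    (ContMDiffAt.comp (I' := 𝓘(ℝ, E)) (y₀, y₀) hs contDiff_fst.contMDiff.contMDiffAt).prodMk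
      (ContMDiffAt.comp (I' := 𝓘(ℝ, E)) (y₀, y₀) hs contDiff_snd.contMDiff.contMDiffAt)
  have he : ContMDiffAt 𝓘(ℝ, E) 𝓘(ℝ, E) ∞ (extChartAt 𝓘(ℝ, E) (1 : G))
      (c ((extChartAt 𝓘(ℝ, E) (1 : G)).symm y₀, (extChartAt 𝓘(ℝ, E) (1 : G)).symm y₀)) := by
    rw [hinv, h1]
    exact contMDiffAt_extChartAt
  exact (ContMDiffAt.comp (I' := 𝓘(ℝ, E)) (y₀, y₀) he
    (ContMDiffAt.comp (I' := 𝓘(ℝ, E).prod 𝓘(ℝ, E)) (y₀, y₀) (hc _) hp)).contDiffAt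

theorem eventually_differentiableAt_chartMap₂ {c : G × G → G}
    (hc : ContMDiff (𝓘(ℝ, E).prod 𝓘(ℝ, E)) 𝓘(ℝ, E) ∞ c) (h1 : c (1, 1) = 1) :
    ∀ᶠ x in 𝓝 (extChartAt 𝓘(ℝ, E) (1 : G) 1),
      DifferentiableAt ℝ (chartMap₂ (E := E) c) (x, extChartAt 𝓘(ℝ, E) (1 : G) 1) ∧
      DifferentiableAt ℝ (chartMap₂ (E := E) c) (extChartAt 𝓘(ℝ, E) (1 : G) 1, x) := by
  set y₀ := extChartAt 𝓘(ℝ, E) (1 : G) 1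
  have h : ∀ᶠ p in 𝓝 (y₀, y₀), DifferentiableAt ℝ (chartMap₂ (E := E) c) p := by
    have h2 := ((contDiffAt_chartMap₂ hc h1).of_le
      (m := 1) (by exact_mod_cast le_top)).eventually (by simp)
    filter_upwards [h2] with p hp
    exact hp.differentiableAt one_ne_zero
  have c1 : Tendsto (fun x ↦ (x, y₀)) (𝓝 y₀) (𝓝 (y₀, y₀)) :=
    (Continuous.prodMk_left y₀).tendsto y₀
  have c2 : Tendsto (fun x ↦ (y₀, x)) (𝓝 y₀) (𝓝 (y₀, y₀)) :=
    (Continuous.prodMk_right y₀).tendsto y₀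
  exact (c1.eventually h).and (c2.eventually h)

/-- The derivative of `Ad` at `1` is `ad`, in the chart at `1`. -/
theorem fderiv_groupAdVec_chart [CompleteSpace E] (X : E) :
    DifferentiableAt ℝ (fun x : E ↦
      groupAdVec X ((extChartAt 𝓘(ℝ, E) (1 : G)).symm x)) (extChartAt 𝓘(ℝ, E) (1 : G) 1) ∧
    ∀ Z : E, fderiv ℝ (fun x : E ↦
      groupAdVec X ((extChartAt 𝓘(ℝ, E) (1 : G)).symm x)) (extChartAt 𝓘(ℝ, E) (1 : G) 1) Z =
        mlieBracket 𝓘(ℝ, E) (mulInvariantVectorField (G := G) (I := 𝓘(ℝ, E)) Z)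
          (mulInvariantVectorField X) (1 : G) := by
  have hn : (∞ : ℕ∞ω) ≠ 0 := by simp
  have : IsManifold 𝓘(ℝ, E) ∞ G := inferInstance
  have : IsManifold 𝓘(ℝ, E) 1 G := IsManifold.of_le (n := ∞) (by exact_mod_cast le_top)
  let mul : G × G → G := fun p ↦ p.1 * p.2
  let conj : G × G → G := fun p ↦ p.1 * p.2 * p.1⁻¹
  have hmul : ContMDiff (𝓘(ℝ, E).prod 𝓘(ℝ, E)) 𝓘(ℝ, E) ∞ mul := contMDiff_mul 𝓘(ℝ, E) ∞
  have hconj : ContMDiff (𝓘(ℝ, E).prod 𝓘(ℝ, E)) 𝓘(ℝ, E) ∞ conj :=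
    (contMDiff_fst.mul contMDiff_snd).mul contMDiff_fst.inv
  have hmul1 : mul (1, 1) = 1 := mul_one 1
  have hconj1 : conj (1, 1) = 1 := by simp [conj]
  have hL : ∀ a : G, MDifferentiable 𝓘(ℝ, E) 𝓘(ℝ, E) (fun b : G ↦ a * b) := fun a ↦
    (contMDiff_mul_left (I := 𝓘(ℝ, E)) (n := ∞)).mdifferentiable hn
  have hR : ∀ a : G, MDifferentiable 𝓘(ℝ, E) 𝓘(ℝ, E) (fun b : G ↦ b * a) := fun a ↦
    (contMDiff_mul_right (I := 𝓘(ℝ, E)) (n := ∞)).mdifferentiable hn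
  have hC : ∀ a : G, MDifferentiable 𝓘(ℝ, E) 𝓘(ℝ, E) (fun b : G ↦ a * b * a⁻¹) := fun a ↦
    (hR a⁻¹).comp (hL a)
  set φ := extChartAt 𝓘(ℝ, E) (1 : G) with hφ
  set y₀ : E := φ 1 with hy₀
  have hinv : φ.symm y₀ = 1 := extChartAt_to_inv _
  set u : E → E := fun x ↦ groupAdVec X (φ.symm x) with hu
  have hmd := eventually_differentiableAt_chartMap₂ hmul hmul1
  have hcd := eventually_differentiableAt_chartMap₂ hconj hconj1
  have hsrc : ∀ᶠ x in 𝓝 y₀, φ.symm x ∈ (chartAt E (1 : G)).source := by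
    filter_upwards [extChartAt_target_mem_nhds (I := 𝓘(ℝ, E)) (1 : G)] with x hx
    have h := φ.map_target hx
    rw [hφ, extChartAt_source] at h
    exact h
  have hφ1 : ∀ v : E, (mfderiv 𝓘(ℝ, E) 𝓘(ℝ, E) φ 1 : E →L[ℝ] E) v = v := by
    intro v
    rw [mfderiv_extChartAt_self]
    rfl
  have hu' : u =ᶠ[𝓝 y₀] fun x ↦ fderiv ℝ (chartMap₂ (E := E) conj) (x, y₀) (0, X) := by
    filter_upwards [hcd] with x hx
    rw [fderiv_chartMap₂_right hx.1]
    have h := mfderiv_chart_mfderiv_one (hC (φ.symm x) 1) (by simp) (mem_chart_source E (1 : G)) X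
    exact (hφ1 _).symm.trans h
  have hfield : ∀ Z : E, chartField (1 : G)
      (mulInvariantVectorField (I := 𝓘(ℝ, E)) (G := G) Z)
      =ᶠ[𝓝 y₀] fun x ↦ fderiv ℝ (chartMap₂ (E := E) mul) (x, y₀) (0, Z) := by
    intro Z
    filter_upwards [hmd, hsrc] with x hx hx'
    rw [fderiv_chartMap₂_right hx.1]
    exact mfderiv_chart_mfderiv_one (hL (φ.symm x) 1) (mul_one _) hx' Z
  have hud : DifferentiableAt ℝ u y₀ := by
    refine DifferentiableAt.congr_of_eventuallyEq ?_ hu'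
    have h1 : DifferentiableAt ℝ (fderiv ℝ (chartMap₂ (E := E) conj)) (y₀, y₀) :=
      ((contDiffAt_chartMap₂ hconj hconj1).fderiv_right (m := 1)
        (by rw [one_add_one_eq_two]; exact ENat.LEInfty.out)).differentiableAt one_ne_zero
    have h2 : DifferentiableAt ℝ (fun x : E ↦ fderiv ℝ (chartMap₂ (E := E) conj) (x, y₀)) y₀ :=
      DifferentiableAt.comp (f := fun x : E ↦ (x, y₀)) y₀ h1
        (hasFDerivAt_prodMk_left y₀ y₀).differentiableAt
    exact h2.clm_apply (differentiableAt_const _)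
  refine ⟨hud, fun Z ↦ ?_⟩
  have hid : ∀ {f : E → E}, f =ᶠ[𝓝 y₀] id → ∀ v, fderiv ℝ f y₀ v = v := by
    intro f hf v
    rw [hf.fderiv_eq, fderiv_id]
    rfl
  have hm2 : ContDiffAt ℝ 2 (chartMap₂ (E := E) mul) (y₀, y₀) :=
    (contDiffAt_chartMap₂ hmul hmul1).of_le ENat.LEInfty.out
  have hl : ∀ v, fderiv ℝ (chartMap₂ (E := E) mul) (y₀, y₀) (v, 0) = v := by
    intro v
    rw [fderiv_chartMap₂_left hmd.self_of_nhds.1]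
    refine hid ?_ v
    filter_upwards [extChartAt_target_mem_nhds (I := 𝓘(ℝ, E)) (1 : G)] with x hx
    change φ (φ.symm x * φ.symm y₀) = x
    rw [hinv, mul_one, φ.right_inv hx]
  have hr : ∀ v, fderiv ℝ (chartMap₂ (E := E) mul) (y₀, y₀) (0, v) = v := by
    intro v
    rw [fderiv_chartMap₂_right hmd.self_of_nhds.1]
    refine hid ?_ v
    filter_upwards [extChartAt_target_mem_nhds (I := 𝓘(ℝ, E)) (1 : G)] with x hx
    change φ (φ.symm y₀ * φ.symm x) = x
    rw [hinv, one_mul, φ.right_inv hx]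
  have hu₀ : u y₀ = X := by
    rw [hu]
    change groupAdVec X (φ.symm y₀) = X
    rw [hinv]
    exact groupAdVec_one X
  -- This is the chart form of `dL_a X = dR_a (Ad(a) X)`, which comes from `a b = (a b a⁻¹) a`.
  have hPR : (fun x ↦ fderiv ℝ (chartMap₂ (E := E) mul) (x, y₀) (0, X)) =ᶠ[𝓝 y₀]
      fun x ↦ fderiv ℝ (chartMap₂ (E := E) mul) (y₀, x) (u x, 0) := by
    filter_upwards [hmd, hsrc] with x hx hx'
    rw [fderiv_chartMap₂_right hx.1, fderiv_chartMap₂_left hx.2]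
    have h1 := mfderiv_chart_mfderiv_one (hL (φ.symm x) 1) (mul_one _) hx' X
    have h2 := mfderiv_chart_mfderiv_one (hR (φ.symm x) 1) (one_mul _) hx' (u x)
    have h3 : (mfderiv 𝓘(ℝ, E) 𝓘(ℝ, E) (fun b : G ↦ φ.symm x * b) 1 : E →L[ℝ] E) X =
        (mfderiv 𝓘(ℝ, E) 𝓘(ℝ, E) (fun b : G ↦ b * φ.symm x) 1 : E →L[ℝ] E) (u x) := by
      have h4 := ((hR (φ.symm x) (φ.symm x * 1 * (φ.symm x)⁻¹)).hasMFDerivAt.comp (1 : G)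
        (hC (φ.symm x) 1).hasMFDerivAt).mfderiv
      have h5 : (fun b : G ↦ b * φ.symm x) ∘ (fun b : G ↦ φ.symm x * b * (φ.symm x)⁻¹) =
          fun b : G ↦ φ.symm x * b := by
        ext b
        simp
      rw [h5] at h4
      have h6 := congrArg (fun T : E →L[ℝ] E ↦ T X) h4
      have key : ∀ (b : G) (v w : E), b = 1 →
          w = (mfderiv 𝓘(ℝ, E) 𝓘(ℝ, E) (fun b : G ↦ b * φ.symm x) b : E →L[ℝ] E) v →
          w = (mfderiv 𝓘(ℝ, E) 𝓘(ℝ, E) (fun b : G ↦ b * φ.symm x) 1 : E →L[ℝ] E) v := by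
        rintro _ v w rfl h
        exact h
      exact key _ _ _ (by simp) h6
    refine h1.symm.trans (Eq.trans ?_ h2)
    exact congrArg (mfderiv 𝓘(ℝ, E) 𝓘(ℝ, E) φ (φ.symm x) : E →L[ℝ] E) h3
  rw [fderiv_eq_lieBracket_of_mul hm2 hl hr hud hu₀ hPR,
    mlieBracket_eq_lieBracket_chartField]
  exact ((hfield Z).lieBracket_vectorField_eq (hfield X)).symm

end AdjointDerivative

/-! ### Derivatives of invariant forms along fundamental fields. -/

section InvariantForms

open Filter Topology VectorField Bundle

variable {E F : Type*} [NormedAddCommGroup E] [NormedSpace ℝ E]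
  [NormedAddCommGroup F] [NormedSpace ℝ F]
  {G : Type*} [TopologicalSpace G] [ChartedSpace E G] [Group G]
  {M : Type*} [TopologicalSpace M] [ChartedSpace F M] [MulAction G M]

/-- Translations map fundamental fields to fundamental fields, up to `Ad`. -/
theorem mfderiv_smul_fundamentalField [LieGroup 𝓘(ℝ, E) ∞ G]
    (hact : ContMDiff (𝓘(ℝ, E).prod 𝓘(ℝ, F)) 𝓘(ℝ, F) ∞ (fun p : G × M ↦ p.1 • p.2))
    (X : E) (a : G) (q : M) :
    (mfderiv 𝓘(ℝ, F) 𝓘(ℝ, F) (fun y : M ↦ a • y) (a⁻¹ • q) : F →L[ℝ] F)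
      (fundamentalField (E := E) (G := G) X (a⁻¹ • q)) =
      fundamentalField (E := E) (G := G) (groupAdVec (E := E) X a) q := by
  have hn : (∞ : ℕ∞ω) ≠ 0 := by simp
  have hconj : MDifferentiable 𝓘(ℝ, E) 𝓘(ℝ, E) (fun b : G ↦ a * b * a⁻¹) :=
    ((contMDiff_mul_right (I := 𝓘(ℝ, E)) (n := ∞)).comp
      (contMDiff_mul_left (I := 𝓘(ℝ, E)) (n := ∞))).mdifferentiable hn
  have h1 := (((contMDiff_const_smul_action hact a).mdifferentiable hn
    ((1 : G) • a⁻¹ • q)).hasMFDerivAt.comp (1 : G)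
      ((contMDiff_smul_left hact (a⁻¹ • q)).mdifferentiable hn (1 : G)).hasMFDerivAt).mfderiv
  have h2 := (((contMDiff_smul_left hact q).mdifferentiable hn (a * 1 * a⁻¹)).hasMFDerivAt.comp
    (1 : G) (hconj 1).hasMFDerivAt).mfderiv
  have h3 : (fun y : M ↦ a • y) ∘ (fun b : G ↦ b • a⁻¹ • q) =
      (fun b : G ↦ b • q) ∘ fun b : G ↦ a * b * a⁻¹ := by
    ext b
    simp [mul_smul]
  rw [h3] at h1
  have h4 := congrArg (fun T : E →L[ℝ] F ↦ T X) (h1.symm.trans h2)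
  have key : ∀ (p : M) (b : G) (v : F) (w : E), p = a⁻¹ • q → b = 1 →
      (mfderiv 𝓘(ℝ, F) 𝓘(ℝ, F) (fun y : M ↦ a • y) p : F →L[ℝ] F) v =
        (mfderiv 𝓘(ℝ, E) 𝓘(ℝ, F) (fun b : G ↦ b • q) b : E →L[ℝ] F) w →
      (mfderiv 𝓘(ℝ, F) 𝓘(ℝ, F) (fun y : M ↦ a • y) (a⁻¹ • q) : F →L[ℝ] F) v =
        (mfderiv 𝓘(ℝ, E) 𝓘(ℝ, F) (fun b : G ↦ b • q) 1 : E →L[ℝ] F) w := by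
    rintro _ _ v w rfl rfl h
    exact h
  exact key _ _ _ _ (one_smul G _) (by simp) h4

theorem invariantForm_fundamentalField [LieGroup 𝓘(ℝ, E) ∞ G]
    (hact : ContMDiff (𝓘(ℝ, E).prod 𝓘(ℝ, F)) 𝓘(ℝ, F) ∞ (fun p : G × M ↦ p.1 • p.2))
    {B : Π x : M, TangentSpace 𝓘(ℝ, F) x →L[ℝ] TangentSpace 𝓘(ℝ, F) x →L[ℝ] ℝ}
    (hB : IsInvariantForm G B) (X Y : E) (a : G) (q : M) :
    B (a⁻¹ • q) (fundamentalField (E := E) (G := G) X (a⁻¹ • q))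
        (fundamentalField (E := E) (G := G) Y (a⁻¹ • q)) =
      B q (fundamentalField (E := E) (G := G) (groupAdVec (E := E) X a) q)
        (fundamentalField (E := E) (G := G) (groupAdVec (E := E) Y a) q) := by
  rw [← hB a]
  have key : ∀ (p : M) (v w v' w' : F), p = q → v = v' → w = w' →
      (B p : F →L[ℝ] F →L[ℝ] ℝ) v w = (B q : F →L[ℝ] F →L[ℝ] ℝ) v' w' := by
    rintro _ v w _ _ rfl rfl rfl
    rfl
  exact key _ _ _ _ _ (smul_inv_smul a q) (mfderiv_smul_fundamentalField hact X a q)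
    (mfderiv_smul_fundamentalField hact Y a q)

variable [CompleteSpace E] [LieGroup 𝓘(ℝ, E) ∞ G] [IsManifold 𝓘(ℝ, F) ∞ M]

/-- The Lie algebra bracket is that of left-invariant fields, and `a ↦ a⁻¹ • q` relates these to
negatives of fundamental fields; hence the sign. -/
theorem mlieBracket_fundamentalField [CompleteSpace F] [LieGroup 𝓘(ℝ, E) (minSmoothness ℝ 3) G]
    (hact : ContMDiff (𝓘(ℝ, E).prod 𝓘(ℝ, F)) 𝓘(ℝ, F) ∞ (fun p : G × M ↦ p.1 • p.2))
    (X Y : GroupLieAlgebra 𝓘(ℝ, E) G) (q : M) :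
    mlieBracket 𝓘(ℝ, F) (fundamentalField X) (fundamentalField Y) q =
      -fundamentalField (M := M) (F := F) ⁅X, Y⁆ q := by
  have hn : (∞ : ℕ∞ω) ≠ 0 := by simp
  have : IsManifold 𝓘(ℝ, E) 2 G := IsManifold.of_le (n := ∞) ENat.LEInfty.out
  have : IsManifold 𝓘(ℝ, F) 2 M := IsManifold.of_le (n := ∞) ENat.LEInfty.out
  -- Using `-X` makes the related field exactly `X*`; the two signs then cancel in the bracket `[-X,
  -- -Y]`.
  have hrel : ∀ (X : GroupLieAlgebra 𝓘(ℝ, E) G) (a : G),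
      mfderiv 𝓘(ℝ, E) 𝓘(ℝ, F) (fun a : G ↦ a⁻¹ • q) a (mulInvariantVectorField (-X) a) =
        fundamentalField X (a⁻¹ • q) := by
    intro X a
    rw [mfderiv_inv_smul_mulInvariantVectorField hact]
    unfold fundamentalField
    exact (congrArg (fun w : F ↦ -w) (map_neg (mfderiv 𝓘(ℝ, E) 𝓘(ℝ, F)
      (fun b : G ↦ b • a⁻¹ • q) 1 : E →L[ℝ] F) X)).trans (neg_neg _)
  have h := mlieBracket_eq_mfderiv_mlieBracket (x₀ := (1 : G)) (f := fun a : G ↦ a⁻¹ • q)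
    ((contMDiff_inv_smul hact q).of_le ENat.LEInfty.out)
    (mdifferentiableAt_mulInvariantVectorField (-X))
    (mdifferentiableAt_mulInvariantVectorField (-Y))
    ((isSmoothVF_fundamentalField hact X).mdifferentiable hn _)
    ((isSmoothVF_fundamentalField hact Y).mdifferentiable hn _) (hrel X) (hrel Y)
  have hb : mlieBracket 𝓘(ℝ, E) (mulInvariantVectorField (-X)) (mulInvariantVectorField (-Y))
      (1 : G) = ⁅X, Y⁆ := by
    rw [← GroupLieAlgebra.bracket_def, neg_lie, lie_neg, neg_neg]
  rw [hb] at h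
  have h' := h.trans (mfderiv_inv_smul_one hact ⁅X, Y⁆ q)
  have key : ∀ (p : M) (w : F), p = q →
      mlieBracket 𝓘(ℝ, F) (fundamentalField X) (fundamentalField Y) p = w →
      mlieBracket 𝓘(ℝ, F) (fundamentalField X) (fundamentalField Y) q = w := by
    rintro _ w rfl h
    exact h
  exact key _ _ (by simp) h'

/-- Differentiate `a ↦ B(X*, Y*)` at `a⁻¹ • q` at the unit in two ways: by the chain rule, where
`a⁻¹ • q` has velocity `-Z*`, and after using invariance to write it as a fixed bilinear form in
`Ad(a) X` and `Ad(a) Y`. -/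
theorem mvfderiv_invariantForm
    (hact : ContMDiff (𝓘(ℝ, E).prod 𝓘(ℝ, F)) 𝓘(ℝ, F) ∞ (fun p : G × M ↦ p.1 • p.2))
    {B : Π x : M, TangentSpace 𝓘(ℝ, F) x →L[ℝ] TangentSpace 𝓘(ℝ, F) x →L[ℝ] ℝ}
    (hBs : ContMDiff 𝓘(ℝ, F) (𝓘(ℝ, F).prod 𝓘(ℝ, F →L[ℝ] F →L[ℝ] ℝ)) ∞
      (fun x ↦ TotalSpace.mk' (F →L[ℝ] F →L[ℝ] ℝ)
        (E := fun x : M ↦ TangentSpace 𝓘(ℝ, F) x →L[ℝ] TangentSpace 𝓘(ℝ, F) x →L[ℝ] ℝ) x (B x)))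
    (hB : IsInvariantForm G B) (X Y Z : GroupLieAlgebra 𝓘(ℝ, E) G) (q : M) :
    mvfderiv 𝓘(ℝ, F) (fun y ↦ B y (fundamentalField X y) (fundamentalField Y y)) q
        (fundamentalField Z q) =
      -B q (fundamentalField ⁅Z, X⁆ q) (fundamentalField Y q)
        - B q (fundamentalField X q) (fundamentalField ⁅Z, Y⁆ q) := by
  have hn : (∞ : ℕ∞ω) ≠ 0 := by simp
  have hsm : MDifferentiable 𝓘(ℝ, F) 𝓘(ℝ, ℝ)
      (fun y : M ↦ B y (fundamentalField X y) (fundamentalField Y y)) := by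
    intro y
    have h1 := (hBs y).clm_bundle_apply₂ (F₃ := ℝ) (E₃ := fun _ ↦ ℝ)
      (isSmoothVF_fundamentalField hact X y) (isSmoothVF_fundamentalField hact Y y)
    simp only [contMDiffAt_section] at h1
    exact h1.mdifferentiableAt hn
  set k : G → ℝ := fun a ↦ B (a⁻¹ • q) (fundamentalField X (a⁻¹ • q))
    (fundamentalField Y (a⁻¹ • q)) with hk
  let D : E →L[ℝ] F := mfderiv 𝓘(ℝ, E) 𝓘(ℝ, F) (fun a : G ↦ a • q) 1
  let Bq : F →L[ℝ] F →L[ℝ] ℝ := B q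
  let C : E →L[ℝ] E →L[ℝ] ℝ := Bq.bilinearComp D D
  have hkC : k = fun a ↦ C (groupAdVec (E := E) X a) (groupAdVec (E := E) Y a) := by
    ext a
    exact invariantForm_fundamentalField hact hB X Y a q
  have hinv := contMDiff_inv_smul hact q
  have h1 := (((hsm ((1 : G)⁻¹ • q)).hasMFDerivAt).comp (1 : G)
    (hinv.mdifferentiable hn (1 : G)).hasMFDerivAt)
  have hkd : MDifferentiableAt 𝓘(ℝ, E) 𝓘(ℝ, ℝ) k 1 := h1.mdifferentiableAt
  have h2 := congrArg (fun T : E →L[ℝ] ℝ ↦ T Z) h1.mfderiv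
  have h3 : (mfderiv 𝓘(ℝ, E) 𝓘(ℝ, ℝ) k 1 : E →L[ℝ] ℝ) Z =
      -mvfderiv 𝓘(ℝ, F) (fun y ↦ B y (fundamentalField X y) (fundamentalField Y y)) q
        (fundamentalField Z q) := by
    have key : ∀ (p : M) (v : F), p = q → v = -fundamentalField Z q →
        (mfderiv 𝓘(ℝ, F) 𝓘(ℝ, ℝ) (fun y ↦ B y (fundamentalField X y) (fundamentalField Y y)) p :
          F →L[ℝ] ℝ) v =
        -mvfderiv 𝓘(ℝ, F) (fun y ↦ B y (fundamentalField X y) (fundamentalField Y y)) q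
        (fundamentalField Z q) := by
      rintro _ _ rfl rfl
      exact map_neg (mfderiv 𝓘(ℝ, F) 𝓘(ℝ, ℝ)
        (fun y ↦ B y (fundamentalField X y) (fundamentalField Y y)) _ : F →L[ℝ] ℝ) _
    exact h2.trans (key _ _ (by simp) (mfderiv_inv_smul_one hact Z q))
  have h4 : (mfderiv 𝓘(ℝ, E) 𝓘(ℝ, ℝ) k 1 : E →L[ℝ] ℝ) =
      fderiv ℝ (k ∘ (extChartAt 𝓘(ℝ, E) (1 : G)).symm) (extChartAt 𝓘(ℝ, E) (1 : G) 1) := by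
    have h := hkd.mfderiv
    rw [ModelWithCorners.range_eq_univ, fderivWithin_univ] at h
    exact h
  obtain ⟨hX, hX'⟩ := fderiv_groupAdVec_chart (E := E) (G := G) (X : E)
  obtain ⟨hY, hY'⟩ := fderiv_groupAdVec_chart (E := E) (G := G) (Y : E)
  let X' : E := X
  let Y' : E := Y
  let zx : GroupLieAlgebra 𝓘(ℝ, E) G := ⁅Z, X⁆
  let zy : GroupLieAlgebra 𝓘(ℝ, E) G := ⁅Z, Y⁆
  let zx' : E := zx
  let zy' : E := zy
  have leibniz : ∀ {u w : E → E} {y₀ Z u₀ w₀ u₁ w₁ : E}, DifferentiableAt ℝ u y₀ →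
      DifferentiableAt ℝ w y₀ → u y₀ = u₀ → w y₀ = w₀ → fderiv ℝ u y₀ Z = u₁ →
      fderiv ℝ w y₀ Z = w₁ →
      fderiv ℝ (fun x ↦ C (u x) (w x)) y₀ Z = C u₀ w₁ + C u₁ w₀ := by
    rintro u w y₀ Z _ _ _ _ hu hw rfl rfl rfl rfl
    have h : HasFDerivAt (fun x ↦ C (u x)) (C.comp (fderiv ℝ u y₀)) y₀ :=
      C.hasFDerivAt.comp y₀ hu.hasFDerivAt
    rw [(h.clm_apply hw.hasFDerivAt).fderiv]
    simp
  have hinv1 : (extChartAt 𝓘(ℝ, E) (1 : G)).symm (extChartAt 𝓘(ℝ, E) (1 : G) 1) = 1 :=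
    extChartAt_to_inv _
  have hone : ∀ X : E, groupAdVec X ((extChartAt 𝓘(ℝ, E) (1 : G)).symm
      (extChartAt 𝓘(ℝ, E) (1 : G) 1)) = X := by
    intro X
    rw [hinv1, groupAdVec_one]
  have h5 : fderiv ℝ (k ∘ (extChartAt 𝓘(ℝ, E) (1 : G)).symm) (extChartAt 𝓘(ℝ, E) (1 : G) 1) Z =
      C X' zy' + C zx' Y' := by
    rw [hkC]
    exact leibniz hX hY (hone X) (hone Y) (hX' Z) (hY' Z)
  have h7 := (congrArg (fun T : E →L[ℝ] ℝ ↦ T Z) h4).trans h5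
  have h8 := h3.symm.trans h7
  rw [← neg_eq_iff_eq_neg.2 h8.symm]
  change -(B q (fundamentalField X q) (fundamentalField ⁅Z, Y⁆ q) +
    B q (fundamentalField ⁅Z, X⁆ q) (fundamentalField Y q)) = _
  ring

end InvariantForms

/-! ### Covariant derivatives of invariant forms. -/

section TorsionFree

open VectorField Bundle

variable {E F : Type*} [NormedAddCommGroup E] [NormedSpace ℝ E]
  [NormedAddCommGroup F] [NormedSpace ℝ F] [FiniteDimensional ℝ F]
  {G : Type*} [TopologicalSpace G] [ChartedSpace E G] [Group G]
  {M : Type*} [TopologicalSpace M] [ChartedSpace F M] [MulAction G M]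
  [LieGroup 𝓘(ℝ, E) ∞ G] [IsManifold 𝓘(ℝ, F) ∞ M]

theorem torsionFree_fundamentalField [CompleteSpace E] [CompleteSpace F]
    [LieGroup 𝓘(ℝ, E) (minSmoothness ℝ 3) G]
    (hact : ContMDiff (𝓘(ℝ, E).prod 𝓘(ℝ, F)) 𝓘(ℝ, F) ∞ (fun p : G × M ↦ p.1 • p.2))
    {nabla : TangentConnection F M} (htor : nabla.torsion = 0)
    (X Y : GroupLieAlgebra 𝓘(ℝ, E) G) (q : M) :
    nabla (fundamentalField Y) q (fundamentalField X q) -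
      nabla (fundamentalField X) q (fundamentalField Y q) = -fundamentalField ⁅X, Y⁆ q := by
  have hn : (∞ : ℕ∞ω) ≠ 0 := by simp
  rw [← mlieBracket_fundamentalField hact]
  exact nabla.torsion_eq_zero_iff.1 htor
    ((isSmoothVF_fundamentalField hact X).mdifferentiable hn q)
    ((isSmoothVF_fundamentalField hact Y).mdifferentiable hn q)

/-- The covariant derivative of an invariant form along fundamental fields. -/
theorem covDerivTensor_fundamentalField [CompleteSpace E] [CompleteSpace F]
    [LieGroup 𝓘(ℝ, E) (minSmoothness ℝ 3) G]
    (hact : ContMDiff (𝓘(ℝ, E).prod 𝓘(ℝ, F)) 𝓘(ℝ, F) ∞ (fun p : G × M ↦ p.1 • p.2))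
    {nabla : TangentConnection F M} (htor : nabla.torsion = 0)
    {B : Π x : M, TangentSpace 𝓘(ℝ, F) x →L[ℝ] TangentSpace 𝓘(ℝ, F) x →L[ℝ] ℝ}
    (hBs : ContMDiff 𝓘(ℝ, F) (𝓘(ℝ, F).prod 𝓘(ℝ, F →L[ℝ] F →L[ℝ] ℝ)) ∞
      (fun x ↦ TotalSpace.mk' (F →L[ℝ] F →L[ℝ] ℝ)
        (E := fun x : M ↦ TangentSpace 𝓘(ℝ, F) x →L[ℝ] TangentSpace 𝓘(ℝ, F) x →L[ℝ] ℝ) x (B x)))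
    (hB : IsInvariantForm G B) (X Y Z : GroupLieAlgebra 𝓘(ℝ, E) G) (q : M) :
    covDerivTensor nabla B (fundamentalField X) (fundamentalField Y) (fundamentalField Z) q =
      -B q (nabla (fundamentalField X) q (fundamentalField Y q)) (fundamentalField Z q) -
        B q (fundamentalField Y q) (nabla (fundamentalField X) q (fundamentalField Z q)) := by
  unfold covDerivTensor
  have hY := torsionFree_fundamentalField hact htor X Y q
  have hZ := torsionFree_fundamentalField hact htor X Z q
  -- Substituting `[X, Y]* = ∇_{Y*} X* - ∇_{X*} Y*`, and likewise for `Z`, cancels the derivatives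
  -- of `Y*` and `Z*`. Only those of `X*` remain.
  rw [mvfderiv_invariantForm hact hBs hB, ← neg_eq_iff_eq_neg.2 hY, ← neg_eq_iff_eq_neg.2 hZ]
  simp only [map_neg, map_sub, neg_apply, sub_apply]
  ring

end TorsionFree

/-! ### The identification of `𝔪` with the tangent space at the base point. -/

section QuotientTangent

variable {E F : Type*} [NormedAddCommGroup E] [NormedSpace ℝ E]
  [NormedAddCommGroup F] [NormedSpace ℝ F]
  {G : Type*} [TopologicalSpace G] [ChartedSpace E G] [Group G]
  {H : Subgroup G} [ChartedSpace F (G ⧸ H)]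

theorem fundamentalField_one_coset (X : GroupLieAlgebra 𝓘(ℝ, E) G) :
    (fundamentalField X ((1 : G) : G ⧸ H) : F) =
      (mfderiv 𝓘(ℝ, E) 𝓘(ℝ, F) (fun a : G ↦ (a : G ⧸ H)) 1 : E →L[ℝ] F) X := by
  have h : (fun a : G ↦ a • ((1 : G) : G ⧸ H)) = fun a : G ↦ (a : G ⧸ H) := by
    ext a
    change ((a * 1 : G) : G ⧸ H) = a
    rw [mul_one]
  have key : ∀ f : G → G ⧸ H, (fun a : G ↦ a • ((1 : G) : G ⧸ H)) = f →
      (fundamentalField X ((1 : G) : G ⧸ H) : F) =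
        (mfderiv 𝓘(ℝ, E) 𝓘(ℝ, F) f 1 : E →L[ℝ] F) X := by
    rintro _ rfl
    rfl
  exact key _ h

variable [LieGroup 𝓘(ℝ, E) ∞ G]

/-- The projection is constant on a curve in `H`; conversely, a vector killed by its derivative is
the velocity of a curve in the fiber through `1`, which is `H`. -/
theorem mem_subgroupLieAlgebra_iff
    (hproj : Manifold.IsSubmersion 𝓘(ℝ, E) 𝓘(ℝ, F) ∞ (fun a : G ↦ (a : G ⧸ H)))
    (X : GroupLieAlgebra 𝓘(ℝ, E) G) :
    X ∈ subgroupLieAlgebra H ↔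
      (mfderiv 𝓘(ℝ, E) 𝓘(ℝ, F) (fun a : G ↦ (a : G ⧸ H)) 1 : E →L[ℝ] F) X = 0 := by
  have hn : (∞ : ℕ∞ω) ≠ 0 := by simp
  constructor
  · rintro ⟨γ, hγ, h0, hH, rfl⟩
    have h1 := (((hproj.contMDiff.mdifferentiable hn) (γ 0)).hasMFDerivAt.comp (0 : ℝ)
      ((hγ.mdifferentiable hn) 0).hasMFDerivAt).mfderiv
    have h2 : (fun a : G ↦ (a : G ⧸ H)) ∘ γ = fun _ ↦ ((1 : G) : G ⧸ H) := by
      ext t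
      exact QuotientGroup.eq.2 (by simpa using hH t)
    rw [h2, mfderiv_const] at h1
    have key : ∀ (b : G) (v : E), b = 1 →
        (0 : F) = (mfderiv 𝓘(ℝ, E) 𝓘(ℝ, F) (fun a : G ↦ (a : G ⧸ H)) b : E →L[ℝ] F) v →
        (mfderiv 𝓘(ℝ, E) 𝓘(ℝ, F) (fun a : G ↦ (a : G ⧸ H)) 1 : E →L[ℝ] F) v = 0 := by
      rintro _ v rfl h
      exact h.symm
    exact key _ _ h0 (congrArg (fun T : ℝ →L[ℝ] F ↦ T 1) h1)
  · intro hX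
    obtain ⟨γ, hγ, h0, hc, hv⟩ := (hproj.isSubmersionAt 1).exists_curve hX
    refine ⟨γ, hγ, h0, fun t ↦ ?_, hv⟩
    simpa using QuotientGroup.eq.1 (hc t).symm

namespace ReductiveDecomposition

theorem toTangent_injective (D : ReductiveDecomposition E H)
    (hproj : Manifold.IsSubmersion 𝓘(ℝ, E) 𝓘(ℝ, F) ∞ (fun a : G ↦ (a : G ⧸ H))) :
    Function.Injective (D.toTangent (F := F)) := by
  rw [injective_iff_map_eq_zero]
  intro X hX
  have h := (mem_subgroupLieAlgebra_iff hproj (X : GroupLieAlgebra 𝓘(ℝ, E) G)).2 hX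
  exact Subtype.ext (Submodule.disjoint_def.1 D.isCompl.disjoint X X.2 h)

/-- The `𝔥`-component lies in the kernel of the derivative of the projection, so dropping it changes
nothing. -/
theorem toTangent_projectionOnto (D : ReductiveDecomposition E H)
    (hproj : Manifold.IsSubmersion 𝓘(ℝ, E) 𝓘(ℝ, F) ∞ (fun a : G ↦ (a : G ⧸ H)))
    (X : GroupLieAlgebra 𝓘(ℝ, E) G) :
    (D.toTangent (D.m.projectionOnto (subgroupLieAlgebra H) D.isCompl X) : F) =
      (mfderiv 𝓘(ℝ, E) 𝓘(ℝ, F) (fun a : G ↦ (a : G ⧸ H)) 1 : E →L[ℝ] F) X := by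
  set Y := D.m.projectionOnto (subgroupLieAlgebra H) D.isCompl X with hY
  have h : X - (Y : GroupLieAlgebra 𝓘(ℝ, E) G) ∈ subgroupLieAlgebra H := by
    rw [← Submodule.projectionOnto_apply_eq_zero_iff D.isCompl, map_sub,
      Submodule.projectionOnto_apply_left, ← hY, sub_self]
  have h' := (mem_subgroupLieAlgebra_iff hproj _).1 h
  have h3 := map_sub (mfderiv 𝓘(ℝ, E) 𝓘(ℝ, F) (fun a : G ↦ (a : G ⧸ H)) 1 : E →L[ℝ] F)
    (X : E) (Y : GroupLieAlgebra 𝓘(ℝ, E) G)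
  exact (sub_eq_zero.1 (h3.symm.trans h')).symm

theorem toTangent_surjective (D : ReductiveDecomposition E H)
    (hproj : Manifold.IsSubmersion 𝓘(ℝ, E) 𝓘(ℝ, F) ∞ (fun a : G ↦ (a : G ⧸ H))) :
    Function.Surjective (D.toTangent (F := F)) := by
  intro v
  obtain ⟨X, hX⟩ := (hproj.isSubmersionAt 1).mfderiv_surjective v
  exact ⟨_, (D.toTangent_projectionOnto hproj X).trans hX⟩

end ReductiveDecomposition

end QuotientTangent

/-- This settles the degenerate case `𝔪 = 0`, where no eigenspace exists to contradict essentiality.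
-/
theorem isParallel_of_subsingleton {F : Type*} [NormedAddCommGroup F] [NormedSpace ℝ F]
    [Subsingleton F] {M : Type*} [TopologicalSpace M] [ChartedSpace F M] [IsManifold 𝓘(ℝ, F) ∞ M]
    (nabla : TangentConnection F M) (A : SymTensorField F M) : IsParallel nabla A := by
  intro X Y Z _ _ _ x
  have h : ∀ v : TangentSpace 𝓘(ℝ, F) x, v = 0 := fun v ↦ Subsingleton.elim (α := F) v 0
  unfold covDerivTensor
  rw [h (X x), h (Y x), h (Z x)]
  simp

/-! ### Transfer of the geometry to `𝔪` and conclusion. -/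

namespace ReductiveDecomposition

variable {E F : Type*} [NormedAddCommGroup E] [NormedSpace ℝ E]
  [NormedAddCommGroup F] [NormedSpace ℝ F]
  {G : Type*} [TopologicalSpace G] [ChartedSpace E G] [Group G] [LieGroup 𝓘(ℝ, E) ∞ G]
  {H : Subgroup G} [ChartedSpace F (G ⧸ H)]

instance [FiniteDimensional ℝ E] (D : ReductiveDecomposition E H) : FiniteDimensional ℝ D.m :=
  haveI : FiniteDimensional ℝ (GroupLieAlgebra 𝓘(ℝ, E) G) := inferInstanceAs (FiniteDimensional ℝ E)
  inferInstance

/-- A bilinear form on the tangent space at the base point, as a bilinear form on `𝔪`. -/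
def pullbackForm (D : ReductiveDecomposition E H)
    (B : TangentSpace 𝓘(ℝ, F) ((1 : G) : G ⧸ H) →L[ℝ]
      TangentSpace 𝓘(ℝ, F) ((1 : G) : G ⧸ H) →L[ℝ] ℝ) : D.m →ₗ[ℝ] D.m →ₗ[ℝ] ℝ :=
  LinearMap.mk₂ ℝ (fun X Y ↦ B (D.toTangent X) (D.toTangent Y))
    (by simp) (by simp) (by simp) (by simp)

theorem toTangent_eq_fundamentalField (D : ReductiveDecomposition E H) (X : D.m) :
    D.toTangent (F := F) X =
      fundamentalField (X : GroupLieAlgebra 𝓘(ℝ, E) G) ((1 : G) : G ⧸ H) :=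
  (fundamentalField_one_coset (X : GroupLieAlgebra 𝓘(ℝ, E) G)).symm

variable [FiniteDimensional ℝ E]

theorem toTangent_bracket (D : ReductiveDecomposition E H)
    (hproj : Manifold.IsSubmersion 𝓘(ℝ, E) 𝓘(ℝ, F) ∞ (fun a : G ↦ (a : G ⧸ H))) (X Y : D.m) :
    haveI : CompleteSpace E := FiniteDimensional.complete ℝ E
    haveI : LieGroup 𝓘(ℝ, E) (minSmoothness ℝ 3) G := lieGroup_minSmoothness
    (D.toTangent (D.bracket X Y) : F) =
      fundamentalField (⁅(X : GroupLieAlgebra 𝓘(ℝ, E) G), (Y : GroupLieAlgebra 𝓘(ℝ, E) G)⁆)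
        ((1 : G) : G ⧸ H) :=
  (D.toTangent_projectionOnto hproj _).trans (fundamentalField_one_coset _).symm

variable [FiniteDimensional ℝ F] [IsManifold 𝓘(ℝ, F) ∞ (G ⧸ H)]

theorem isAlgIdeal_eigenspace (D : ReductiveDecomposition E H)
    (hproj : Manifold.IsSubmersion 𝓘(ℝ, E) 𝓘(ℝ, F) ∞ (fun a : G ↦ (a : G ⧸ H)))
    {g : SmoothMetric F (G ⧸ H)} (hg : IsInvariantForm G g.inner)
    {nabla : TangentConnection F (G ⧸ H)} (hnabla : IsLeviCivita g nabla)
    {A : SymTensorField F (G ⧸ H)} (hA : IsInvariantForm G A.form) (hcod : IsCodazzi nabla A)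
    (hsolv : IsNilpotentAlg D.bracket ∨ IsSplitSolvableAlg D.bracket) :
    (∀ c, IsAlgIdeal D.bracket (D.eigenspace g A c)) ∧
      (Nontrivial D.m → ∃ c, D.eigenspace g A c ≠ ⊥) := by
  have : CompleteSpace E := FiniteDimensional.complete ℝ E
  have : CompleteSpace F := FiniteDimensional.complete ℝ F
  have : LieGroup 𝓘(ℝ, E) (minSmoothness ℝ 3) G := lieGroup_minSmoothness
  have hact := contMDiff_smul_quotient hproj
  let e : D.m ≃ₗ[ℝ] TangentSpace 𝓘(ℝ, F) ((1 : G) : G ⧸ H) :=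
    LinearEquiv.ofBijective D.toTangent
      ⟨D.toTangent_injective hproj, D.toTangent_surjective hproj⟩
  let fund (X : D.m) : Π x : G ⧸ H, TangentSpace 𝓘(ℝ, F) x :=
    fundamentalField (X : GroupLieAlgebra 𝓘(ℝ, E) G)
  have hsm (X : D.m) : IsSmoothVF (fund X) := isSmoothVF_fundamentalField hact _
  have hfund (X : D.m) : fund X ((1 : G) : G ⧸ H) = D.toTangent X :=
    (D.toTangent_eq_fundamentalField X).symm
  -- The first argument is the field being differentiated, the second the direction. With this order
  -- `L X Y - L Y X` is `+[X, Y]_𝔪` despite the sign in the bracket of fundamental fields.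
  let L (X Y : D.m) : D.m := e.symm (nabla (fund X) ((1 : G) : G ⧸ H) (D.toTangent Y))
  have hL (X Y : D.m) :
      D.toTangent (L X Y) = nabla (fund X) ((1 : G) : G ⧸ H) (D.toTangent Y) :=
    e.apply_symm_apply _
  have hcov (B : Π x : G ⧸ H, TangentSpace 𝓘(ℝ, F) x →L[ℝ] TangentSpace 𝓘(ℝ, F) x →L[ℝ] ℝ)
      (hBs : ContMDiff 𝓘(ℝ, F) (𝓘(ℝ, F).prod 𝓘(ℝ, F →L[ℝ] F →L[ℝ] ℝ)) ∞
        (fun x ↦ Bundle.TotalSpace.mk' (F →L[ℝ] F →L[ℝ] ℝ)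
        (E := fun x : G ⧸ H ↦
          TangentSpace 𝓘(ℝ, F) x →L[ℝ] TangentSpace 𝓘(ℝ, F) x →L[ℝ] ℝ) x (B x)))
      (hB : IsInvariantForm G B) (X Y Z : D.m) :
      covDerivTensor nabla B (fund X) (fund Y) (fund Z) ((1 : G) : G ⧸ H) =
        -D.pullbackForm (B ((1 : G) : G ⧸ H)) (L X Y) Z
          - D.pullbackForm (B ((1 : G) : G ⧸ H)) Y (L X Z) := by
    refine (covDerivTensor_fundamentalField hact hnabla.torsion_free hBs hB _ _ _ _).trans ?_
    change -B _ (nabla (fund X) _ (fund Y _)) (fund Z _) -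
      B _ (fund Y _) (nabla (fund X) _ (fund Z _)) = -B _ (D.toTangent _) (D.toTangent _) -
      B _ (D.toTangent _) (D.toTangent _)
    rw [hL, hL, hfund, hfund]
  set gm := D.pullbackForm (g.inner ((1 : G) : G ⧸ H)) with hgm
  set Am := D.pullbackForm (A.form ((1 : G) : G ⧸ H)) with hAm
  have hgsymm (X Y : D.m) : gm X Y = gm Y X := g.symm _ _ _
  have hAsymm (X Y : D.m) : Am X Y = Am Y X := A.symm _ _ _
  have hgpos (X : D.m) (hX : X ≠ 0) : 0 < gm X X :=
    g.pos _ _ fun h ↦ hX (D.toTangent_injective hproj (h.trans (map_zero _).symm))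
  have hgdef (X : D.m) (hX : gm X X = 0) : X = 0 := by
    by_contra h
    exact (hgpos X h).ne' hX
  obtain ⟨S, hS⟩ := exists_operator_of_bilinForm gm Am hgdef
  have hSsymm (X Y : D.m) : gm (S X) Y = gm X (S Y) := by
    rw [hS, hgsymm X, hS, hAsymm]
  -- Definiteness of `gm` turns the condition tested against all `Y` into `S X = c X`.
  have heig (c : ℝ) : D.eigenspace g A c = LinearMap.ker (S - c • LinearMap.id) := by
    ext X
    have h1 : X ∈ D.eigenspace g A c ↔ ∀ Y, Am X Y = c * gm X Y := Iff.rfl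
    rw [h1, LinearMap.mem_ker]
    have h2 (Y : D.m) : gm ((S - c • (LinearMap.id : D.m →ₗ[ℝ] D.m)) X) Y = Am X Y - c * gm X Y := by
      simp [hS]
    refine ⟨fun h ↦ hgdef _ ?_, fun h Y ↦ ?_⟩
    · rw [h2, h, sub_self]
    · rw [← sub_eq_zero, ← h2, h]
      simp
  have htor (X Y : D.m) : L X Y - L Y X = D.bracket X Y := by
    apply D.toTangent_injective hproj
    rw [map_sub, hL, hL, ← hfund, ← hfund]
    have h := torsionFree_fundamentalField hact hnabla.torsion_free
      (X : GroupLieAlgebra 𝓘(ℝ, E) G) Y ((1 : G) : G ⧸ H)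
    rw [← neg_sub]
    refine (congrArg (fun v : F ↦ -v) h).trans ((neg_neg _).trans ?_)
    exact (D.toTangent_bracket hproj X Y).symm
  have hskew (X Y : D.m) : D.bracket X Y = -D.bracket Y X := by
    rw [← htor, ← htor, neg_sub]
  have hmet (X Y Z : D.m) : gm (L Z X) Y + gm X (L Z Y) = 0 := by
    have h := hcov g.inner g.contMDiff hg Z X Y
    rw [hnabla.metric _ _ _ (hsm Z) (hsm X) (hsm Y)] at h
    linarith
  have hcodm (X Y Z : D.m) :
      gm (S (L X Y)) Z + gm (S Y) (L X Z) = gm (S (L Y X)) Z + gm (S X) (L Y Z) := by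
    have h := hcod _ _ _ (hsm X) (hsm Y) (hsm Z) ((1 : G) : G ⧸ H)
    rw [hcov _ A.contMDiff hA, hcov _ A.contMDiff hA] at h
    simp only [hS]
    linarith
  refine ⟨fun c ↦ ?_, fun _ ↦ ?_⟩
  · rw [heig]
    exact isAlgIdeal_of_codazzi D.bracket hskew hsolv gm hgsymm hgdef S hSsymm L htor hmet hcodm c
  · simp only [heig]
    exact exists_ker_sub_smul_ne_bot gm hgsymm hgpos S hSsymm

end ReductiveDecomposition

end

theorem proposition2p3 {E F : Type*} [NormedAddCommGroup E] [NormedSpace ℝ E]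
    [FiniteDimensional ℝ E] [NormedAddCommGroup F] [NormedSpace ℝ F] [FiniteDimensional ℝ F]
    {G : Type*} [TopologicalSpace G] [ChartedSpace E G] [Group G] [LieGroup 𝓘(ℝ, E) ∞ G]
    (H : Subgroup G) (hH : IsClosed (H : Set G))
    -- the smooth structure on `G ⧸ H` for which the projection is a submersion
    [ChartedSpace F (G ⧸ H)] [IsManifold 𝓘(ℝ, F) ∞ (G ⧸ H)]
    (hproj : Manifold.IsSubmersion 𝓘(ℝ, E) 𝓘(ℝ, F) ∞ (fun a : G ↦ (a : G ⧸ H)))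
    (D : ReductiveDecomposition E H)
    (g : SmoothMetric F (G ⧸ H)) (hg : IsInvariantForm G g.inner)
    (nabla : TangentConnection F (G ⧸ H)) (hnabla : IsLeviCivita g nabla)
    (A : SymTensorField F (G ⧸ H)) (hA : D.IsEssentialCodazzi g nabla A) :
    ¬ IsNilpotentAlg D.bracket ∧ ¬ IsSplitSolvableAlg D.bracket := by
  suffices h : ¬ (IsNilpotentAlg D.bracket ∨ IsSplitSolvableAlg D.bracket) from not_or.1 h
  intro hsolv
  obtain ⟨hideal, heig⟩ :=
    D.isAlgIdeal_eigenspace hproj hg hnabla hA.invariant hA.codazzi hsolv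
  -- The hypothesis `∇A ≠ 0` enters only when `𝔪 = 0`; otherwise an eigenspace that is an ideal
  -- gives the contradiction.
  rcases subsingleton_or_nontrivial D.m with h | h
  · have : Subsingleton F := (D.toTangent_surjective hproj).subsingleton
    exact hA.not_parallel (isParallel_of_subsingleton nabla A)
  · obtain ⟨c, hc⟩ := heig h
    exact hA.not_ideal c hc (hideal c)
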